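/- Let $K$ be an algebraically closed field of characteristic $0$ and let $A_1=K\langle X,Y\rangle/(YX-XY-1)$ be the first Weyl algebra, with $K$-basis $X^iY^j$ ($i,j\ge 0$). For $P=\sum a_{ij}X^iY^j\ne 0$ in $A_1$ put $\mathrm{Supp}(P)=\{(i,j):a_{ij}\neq 0\}$. For integers $\rho,\sigma$ put $v_{\rho,\sigma}(i,j)=\rho i+\sigma j$ and $v_{\rho,\sigma}(P)=\max\{v_{\rho,\sigma}(i,j):(i,j)\in\mathrm{Supp}(P)\}$; thus $v_{1,1}(P)$ is the total degree of $P$. Let $\mathrm{st}_{1,0}(P)$ be the point of $\{(i,j)\in\mathrm{Supp}(P): i=v_{1,0}(P)\}$ at which $v_{1,-1}$ is maximal, i.e. the one with smallest $j$. Call $P$ *subrectangular* if there are integers $a,b\ge 1$ with $(a,b)\in\mathrm{Supp}(P)\subseteq\{(i,j):0\le i\le a,\ 0\le j\le b\}$. A *counterexample* is a pair $(P,Q)$ of elements of $A_1$ such that there is a $K$-algebra endomorphism of $A_1$ with $X\mapsto P$, $Y\mapsto Q$ which is not an automorphism. Let $B$ be the minimum of $\gcd(v_{1,1}(P),v_{1,1}(Q))$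 over all counterexamples $(P,Q)$ ($B=\infty$ if there are none). A *minimal pair* is a counterexample $(P,Q)$ with $\gcd(v_{1,1}(P),v_{1,1}(Q))=B$. A minimal pair $(P,Q)$ is *standard* if $P$ and $Q$ are subrectangular and $v_{1,-1}(\mathrm{st}_{1,0}(P))<0$ and $v_{1,-1}(\mathrm{st}_{1,0}(Q))<0$. Let $(P,Q)$ be a minimal pair. Then: 1. there is a $K$-algebra automorphism $\varphi$ of $A_1$ such that $(\varphi(P),\varphi(Q))$ is a minimal pair with $\varphi(P)$ and $\varphi(Q)$ subrectangular, $v_{1,1}(\varphi(P))=v_{1,1}(P)$ and $v_{1,1}(\varphi(Q))=v_{1,1}(Q)$; 2. there is a $K$-algebra automorphism $\psi$ of $A_1$ such that $(\psi(P),\psi(Q))$ is a standard minimal pair, $v_{1,1}(\psi(P))=v_{1,1}(P)$ and $v_{1,1}(\psi(Q))=v_{1,1}(Q)$. -/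

import Mathlib

namespace Dixmier

noncomputable section

/-- The defining relation `Y X = X Y + 1` of the Weyl algebra, where the generator `0` is `X` and
the generator `1` is `Y`. -/
inductive WeylRel (K : Type*) [Field K] : FreeAlgebra K (Fin 2) → FreeAlgebra K (Fin 2) → Prop
  | comm : WeylRel K (FreeAlgebra.ι K 1 * FreeAlgebra.ι K 0)
      (FreeAlgebra.ι K 0 * FreeAlgebra.ι K 1 + 1)

/-- The first Weyl algebra `A₁ = K⟨X, Y⟩ / (Y X - X Y - 1)`. -/
abbrev Weyl (K : Type*) [Field K] : Type _ := RingQuot (WeylRel K)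

/-- The generator `X` of `A₁`. -/
def X (K : Type*) [Field K] : Weyl K := RingQuot.mkAlgHom K (WeylRel K) (FreeAlgebra.ι K 0)

/-- The generator `Y` of `A₁`. -/
def Y (K : Type*) [Field K] : Weyl K := RingQuot.mkAlgHom K (WeylRel K) (FreeAlgebra.ι K 1)

theorem Y_mul_X (K : Type*) [Field K] : Y K * X K = X K * Y K + 1 := by
  have h := RingQuot.mkAlgHom_rel K (WeylRel.comm (K := K))
  rw [map_mul, map_add, map_mul, map_one] at h
  exact h

/-- The commutative polynomial algebra `L = K[x, y]`; `x` is the variable `0`, `y` the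
variable `1`. -/
abbrev Poly (K : Type*) [Field K] : Type _ := MvPolynomial (Fin 2) K

/-- The free algebra acts on `K[x, y]`: `X` by `f ↦ x f` and `Y` by `f ↦ y f + ∂f/∂x`. -/
def freeAct (K : Type*) [Field K] : FreeAlgebra K (Fin 2) →ₐ[K] Module.End K (Poly K) :=
  FreeAlgebra.lift K
    ![LinearMap.mulLeft K (MvPolynomial.X 0 : Poly K),
      LinearMap.mulLeft K (MvPolynomial.X 1 : Poly K) +
        ((MvPolynomial.pderiv 0 : Derivation K (Poly K) (Poly K)) : Poly K →ₗ[K] Poly K)]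

theorem freeAct_rel (K : Type*) [Field K] ⦃a b : FreeAlgebra K (Fin 2)⦄ (h : WeylRel K a b) :
    freeAct K a = freeAct K b := by
  cases h
  apply LinearMap.ext
  intro f
  simp [freeAct, Derivation.leibniz]
  ring

/-- The action of `A₁` on `K[x, y]` induced by `freeAct`. -/
def act (K : Type*) [Field K] : Weyl K →ₐ[K] Module.End K (Poly K) :=
  RingQuot.liftAlgHom K ⟨freeAct K, freeAct_rel K⟩

/-- The `K`-linear map `Ψ : A₁ → K[x, y]` with `Ψ (X ^ i * Y ^ j) = x ^ i * y ^ j`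
(see `Psi_monomial`), realised as `P ↦ P • 1` for the action above. It is a linear isomorphism, see
`Psi_bijective`. -/
def Psi (K : Type*) [Field K] : Weyl K →ₗ[K] Poly K :=
  (LinearMap.applyₗ (1 : Poly K)).comp (act K).toLinearMap

theorem act_X (K : Type*) [Field K] (f : Poly K) : act K (X K) f = MvPolynomial.X 0 * f := by
  simp [act, X, RingQuot.liftAlgHom_mkAlgHom_apply, freeAct]

theorem act_Y (K : Type*) [Field K] (f : Poly K) :
    act K (Y K) f = MvPolynomial.X 1 * f + MvPolynomial.pderiv 0 f := by
  simp [act, Y, RingQuot.liftAlgHom_mkAlgHom_apply, freeAct]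

theorem Psi_monomial (K : Type*) [Field K] (i j : ℕ) :
    Psi K (X K ^ i * Y K ^ j) = MvPolynomial.X 0 ^ i * MvPolynomial.X 1 ^ j := by
  have hY : act K (Y K ^ j) 1 = MvPolynomial.X 1 ^ j := by
    induction j with
    | zero => simp
    | succ j ih =>
      rw [pow_succ', map_mul, Module.End.mul_apply, ih, act_Y, pow_succ']
      simp [Derivation.leibniz_pow, MvPolynomial.pderiv_X]
  change act K (X K ^ i * Y K ^ j) 1 = _
  rw [map_mul, Module.End.mul_apply, hY]
  induction i with
  | zero => simp
  | succ i ih =>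
    rw [pow_succ', map_mul, Module.End.mul_apply, ih, act_X, pow_succ', mul_assoc]

theorem Y_mul_X_pow (K : Type*) [Field K] (i : ℕ) :
    Y K * X K ^ (i + 1) = X K ^ (i + 1) * Y K + (i + 1 : K) • X K ^ i := by
  induction i with
  | zero => simp [Y_mul_X]
  | succ i ih =>
    rw [pow_succ (X K) (i + 1), ← mul_assoc, ih, add_mul, mul_assoc, Y_mul_X, mul_add, mul_one,
      smul_mul_assoc, ← pow_succ, ← mul_assoc, add_assoc]
    congr 1
    push_cast
    module

theorem span_monomials (K : Type*) [Field K] :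
    Submodule.span K (Set.range fun p : ℕ × ℕ => X K ^ p.1 * Y K ^ p.2) = ⊤ := by
  set S := Submodule.span K (Set.range fun p : ℕ × ℕ => X K ^ p.1 * Y K ^ p.2) with hS
  have mem (i j : ℕ) : X K ^ i * Y K ^ j ∈ S := Submodule.subset_span ⟨(i, j), rfl⟩
  have hX (b : Weyl K) (hb : b ∈ S) : X K * b ∈ S := by
    induction hb using Submodule.span_induction with
    | mem b h =>
      obtain ⟨⟨i, j⟩, rfl⟩ := h
      simpa [pow_succ', mul_assoc] using mem (i + 1) j
    | zero => simp
    | add b c _ _ h1 h2 => rw [mul_add]; exact S.add_mem h1 h2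
    | smul r b _ h => rw [mul_smul_comm]; exact S.smul_mem r h
  have hY (b : Weyl K) (hb : b ∈ S) : Y K * b ∈ S := by
    induction hb using Submodule.span_induction with
    | mem b h =>
      obtain ⟨⟨i, j⟩, rfl⟩ := h
      cases i with
      | zero => simpa [pow_succ'] using mem 0 (j + 1)
      | succ i =>
        have h2 : Y K * (X K ^ (i + 1) * Y K ^ j) =
            X K ^ (i + 1) * Y K ^ (j + 1) + (i + 1 : K) • (X K ^ i * Y K ^ j) := by
          rw [← mul_assoc, Y_mul_X_pow, add_mul, mul_assoc, ← pow_succ', smul_mul_assoc]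
        change Y K * (X K ^ (i + 1) * Y K ^ j) ∈ S
        rw [h2]
        exact S.add_mem (mem _ _) (S.smul_mem _ (mem _ _))
    | zero => simp
    | add b c _ _ h1 h2 => rw [mul_add]; exact S.add_mem h1 h2
    | smul r b _ h => rw [mul_smul_comm]; exact S.smul_mem r h
  have key (a : FreeAlgebra K (Fin 2)) :
      ∀ b ∈ S, RingQuot.mkAlgHom K (WeylRel K) a * b ∈ S := by
    induction a with
    | grade0 r =>
      intro b hb
      rw [AlgHom.commutes, ← Algebra.smul_def]
      exact S.smul_mem r hb
    | grade1 k =>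
      intro b hb
      fin_cases k
      · exact hX b hb
      · exact hY b hb
    | mul a c ha hc =>
      intro b hb
      rw [map_mul, mul_assoc]
      exact ha _ (hc _ hb)
    | add a c ha hc =>
      intro b hb
      rw [map_add, add_mul]
      exact S.add_mem (ha _ hb) (hc _ hb)
  rw [eq_top_iff]
  intro a _
  obtain ⟨a, rfl⟩ := RingQuot.mkAlgHom_surjective K (WeylRel K) a
  have h1 : (1 : Weyl K) ∈ S := by simpa using mem 0 0
  simpa using key a 1 h1

/-- The monomials `X ^ i * Y ^ j` form a basis of `A₁`; equivalently `Ψ` is bijective. -/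
theorem Psi_bijective (K : Type*) [Field K] : Function.Bijective (Psi K) := by
  let e (p : ℕ × ℕ) : Fin 2 →₀ ℕ := Finsupp.single 0 p.1 + Finsupp.single 1 p.2
  have he (s : Fin 2 →₀ ℕ) : e (s 0, s 1) = s := by
    ext k; fin_cases k <;> simp [e]
  let G : Poly K →ₗ[K] Weyl K :=
    (MvPolynomial.basisMonomials (Fin 2) K).constr K fun s => X K ^ s 0 * Y K ^ s 1
  have hmon (s : Fin 2 →₀ ℕ) : MvPolynomial.basisMonomials (Fin 2) K s =
      MvPolynomial.X 0 ^ s 0 * MvPolynomial.X 1 ^ s 1 := by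
    rw [MvPolynomial.coe_basisMonomials, ← he s]
    simp [e, MvPolynomial.X_pow_eq_monomial, MvPolynomial.monomial_mul]
  have hG (i j : ℕ) : G (MvPolynomial.X 0 ^ i * MvPolynomial.X 1 ^ j) = X K ^ i * Y K ^ j := by
    have h := (MvPolynomial.basisMonomials (Fin 2) K).constr_basis K
      (fun s => X K ^ s 0 * Y K ^ s 1) (e (i, j))
    rw [hmon] at h
    simpa [e, G] using h
  have h1 : Psi K ∘ₗ G = LinearMap.id := by
    apply (MvPolynomial.basisMonomials (Fin 2) K).ext
    intro s
    rw [hmon, LinearMap.comp_apply, hG, Psi_monomial, LinearMap.id_apply]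
  have h2 : G ∘ₗ Psi K = LinearMap.id := by
    apply LinearMap.ext_on_range (span_monomials K)
    rintro ⟨i, j⟩
    rw [LinearMap.comp_apply, Psi_monomial, hG, LinearMap.id_apply]
  exact ⟨Function.LeftInverse.injective (g := G) (DFunLike.congr_fun h2),
    Function.RightInverse.surjective (g := G) (DFunLike.congr_fun h1)⟩

/-- `v_{ρ,σ}(i, j) = ρ i + σ j`. -/
def val (ρ σ : ℤ) (p : ℤ × ℤ) : ℤ := ρ * p.1 + σ * p.2

/-- The exponent `(i, j)` of a monomial `x ^ i * y ^ j`, as a point of `ℤ × ℤ`. -/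
def point (s : Fin 2 →₀ ℕ) : ℤ × ℤ := ((s 0 : ℤ), (s 1 : ℤ))

/-- The support of `f ∈ K[x, y]`. -/
def polySupp {K : Type*} [Field K] (f : Poly K) : Finset (ℤ × ℤ) := f.support.image point

/-- The `(ρ, σ)`-degree of `f ∈ K[x, y]`, with value `⊥ = -∞` at `f = 0`. -/
def polyDeg {K : Type*} [Field K] (ρ σ : ℤ) (f : Poly K) : WithBot ℤ :=
  (polySupp f).sup fun p => (val ρ σ p : WithBot ℤ)

open Classical in
/-- The `(ρ, σ)`-leading term `ℓ_{ρ,σ}(f)`: the part of `f` of highest `(ρ, σ)`-degree. -/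
def lead {K : Type*} [Field K] (ρ σ : ℤ) (f : Poly K) : Poly K :=
  ∑ s ∈ f.support with (val ρ σ (point s) : WithBot ℤ) = polyDeg ρ σ f,
    MvPolynomial.monomial s (f.coeff s)

/-- `w(f) = (i₀, i₀ - v_{1,-1}(f))`, where `i₀` is the greatest `i` such that
`(i, i - v_{1,-1}(f))` lies in the support of `ℓ_{1,-1}(f)` (for `f ≠ 0`). -/
def w {K : Type*} [Field K] (f : Poly K) : ℤ × ℤ :=
  let d : ℤ := (polyDeg 1 (-1) f).unbotD 0
  let i₀ : ℤ := (((polySupp (lead 1 (-1) f)).filter fun p => p.2 = p.1 - d).image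
    Prod.fst).max.unbotD 0
  (i₀, i₀ - d)

/-- The support of `P ∈ A₁`: the set of `(i, j)` for which `X ^ i * Y ^ j` occurs in `P`. -/
def supp {K : Type*} [Field K] (P : Weyl K) : Finset (ℤ × ℤ) := polySupp (Psi K P)

/-- The `(ρ, σ)`-degree `v_{ρ,σ}(P)` of `P ∈ A₁`. -/
def deg {K : Type*} [Field K] (ρ σ : ℤ) (P : Weyl K) : WithBot ℤ := polyDeg ρ σ (Psi K P)

/-- The total degree `v_{1,1}(P)` of `P ∈ A₁` as a natural number (see `deg_one_one`). -/
def totalDeg {K : Type*} [Field K] (P : Weyl K) : ℕ := (Psi K P).totalDegree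

theorem deg_one_one {K : Type*} [Field K] (P : Weyl K) (hP : P ≠ 0) :
    deg 1 1 P = ((totalDeg P : ℤ) : WithBot ℤ) := by
  have hne : Psi K P ≠ 0 := fun h => hP ((Psi_bijective K).1 (by rw [h, map_zero]))
  have hsum (s : Fin 2 →₀ ℕ) : val 1 1 (point s) = ((s.sum fun _ e => e : ℕ) : ℤ) := by
    rw [Finsupp.sum_fintype _ _ (by simp)]
    simp [val, point]
  apply le_antisymm
  · apply Finset.sup_le
    intro p hp
    obtain ⟨s, hs, rfl⟩ := Finset.mem_image.1 hp
    rw [hsum]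
    exact_mod_cast MvPolynomial.le_totalDegree hs
  · obtain ⟨s, hs, h⟩ := Finset.exists_mem_eq_sup _ (MvPolynomial.support_nonempty.2 hne)
      (fun s : Fin 2 →₀ ℕ => s.sum fun _ e => e)
    have h' : ((totalDeg P : ℕ) : ℤ) = val 1 1 (point s) := by
      rw [hsum]
      exact congrArg _ h
    rw [h']
    exact Finset.le_sup (f := fun p => (val 1 1 p : WithBot ℤ)) (Finset.mem_image_of_mem _ hs)

/-- The starting point `st_{ρ,σ}(P) = w(ℓ_{ρ,σ}(P))` of `P ∈ A₁ \ {0}`. -/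
def st {K : Type*} [Field K] (ρ σ : ℤ) (P : Weyl K) : ℤ × ℤ := w (lead ρ σ (Psi K P))

/-- `P` is subrectangular: for some positive integers `a, b` (the vertex), the support of `P`
contains `(a, b)` and is contained in the rectangle `[0, a] × [0, b]`. -/
def IsSubrectangular {K : Type*} [Field K] (P : Weyl K) : Prop :=
  ∃ a b : ℤ, 0 < a ∧ 0 < b ∧ (a, b) ∈ supp P ∧
    ∀ p ∈ supp P, (0 ≤ p.1 ∧ p.1 ≤ a) ∧ (0 ≤ p.2 ∧ p.2 ≤ b)

/-- `(P, Q)` is a counterexample to the Dixmier conjecture: there is a `K`-algebra endomorphism of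
`A₁` with `X ↦ P`, `Y ↦ Q` that is not an automorphism. -/
def IsCounterexample {K : Type*} [Field K] (P Q : Weyl K) : Prop :=
  ∃ φ : Weyl K →ₐ[K] Weyl K, φ (X K) = P ∧ φ (Y K) = Q ∧ ¬ Function.Bijective φ

/-- The number `B`: the least `gcd (deg P, deg Q)` over all counterexamples `(P, Q)`, and `∞` if
there are none. -/
def minGcd (K : Type*) [Field K] : ℕ∞ :=
  ⨅ p : {p : Weyl K × Weyl K // IsCounterexample p.1 p.2},
    ((Nat.gcd (totalDeg p.1.1) (totalDeg p.1.2) : ℕ) : ℕ∞)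

/-- A minimal pair: a counterexample whose total degrees have greatest common divisor `B`. -/
def IsMinimalPair {K : Type*} [Field K] (P Q : Weyl K) : Prop :=
  IsCounterexample P Q ∧ minGcd K = ((Nat.gcd (totalDeg P) (totalDeg Q) : ℕ) : ℕ∞)

/-- A standard minimal pair. -/
def IsStandardMinimalPair {K : Type*} [Field K] (P Q : Weyl K) : Prop :=
  IsMinimalPair P Q ∧ IsSubrectangular P ∧ IsSubrectangular Q ∧
    val 1 (-1) (st 1 0 P) < 0 ∧ val 1 (-1) (st 1 0 Q) < 0

end

end Dixmier

/-! Give $X$ and $Y$ weights $(\rho,\sigma)$ with $\rho+\sigma>0$. Up to lower order, products in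
$A_1$ multiply leading forms, and commutators take their Poisson bracket. Setting $x=1$ turns
leading forms $f,G$ of degrees $V,N$ into polynomials in one variable $t$, and $\rho$ times their
bracket into $N G f' - V f G'$.

Let $[P,Q]$ be a nonzero constant and let $P$ have degree $V>0$ with leading form $f$. Starting from
$T=Q$, replace $T$ by $T^V-cP^N$ as long as the leading forms of $P$ and $T$ Poisson-commute. The
process stops with a form $G$ whose bracket $u$ with $f$ is nonzero and has a power proportional to
a power of $f$ (`exists_bracketData`). Comparing both sides of the bracket identity at each root of
$f$ and at infinity shows that no root has multiplicity $V/(\rho+\sigma)$, and that $f$ has at most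
one root or its number $r$ of roots satisfies $rV\le(\rho+\sigma)\deg f$ (`rootMultiplicity_G`,
`roots_cases`).

For weight $(1,1)$ this leaves at most two linear factors, so a linear automorphism makes the
leading form $c\,x^ay^b$ (`exists_monomial_top`), with $a\ne b$ (`corner_ne`). A Newton polygon edge
leaving $(a,b)$ to the right is possible only if $a=0$, and then its weight is proportional to
$(m,1)$ (`edge_exponent`). For $a,b>0$ this, together with its mirror image, confines the support to
a rectangle. Minimality excludes $a=0$: a suitable $X\mapsto X+\mu Y^m$ removes $y^V$ and lowers the
degree of $P$. The degrees of $P$ and $Q$ have the same ratio for all weights with $0<\sigma\le\rho$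
(`IsCounterexample.ratio`), so the gcd would drop too (`top_ne_pow`). The case $b=0$ is symmetric.

For a standard pair, swap the variables if necessary so that $a<b$ and use weight $(1,0)$. The
leading form of $P$ has degree $b$ in $t$. If all multiplicities were at most $a$, they would be
less than $a$, giving $b<ra$ against the root bound. Translating $Y$ moves a root of multiplicity
greater than $a$ to $0$, which puts the starting point above the diagonal. The same root serves $Q$,
because powers of the two leading forms are proportional. -/

namespace Dixmier

variable {K : Type*} [Field K]

/-! ### Monomial basis, weighted filtrations and leading components. -/

/-- The exponent of `x ^ i * y ^ j`. -/
noncomputable def expo (p : ℕ × ℕ) : Fin 2 →₀ ℕ := Finsupp.single 0 p.1 + Finsupp.single 1 p.2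

/-- Exponents of monomials in two variables are pairs of natural numbers. -/
noncomputable def expoEquiv : (Fin 2 →₀ ℕ) ≃ ℕ × ℕ where
  toFun s := (s 0, s 1)
  invFun := expo
  left_inv s := by ext k; fin_cases k <;> simp [expo]
  right_inv p := by simp [expo]

/-- The basis of the Weyl algebra formed by the monomials `X ^ i * Y ^ j`. -/
noncomputable def monoBasis (K : Type*) [Field K] : Module.Basis (ℕ × ℕ) K (Weyl K) :=
  ((MvPolynomial.basisMonomials (Fin 2) K).map
    (LinearEquiv.ofBijective (Psi K) (Psi_bijective K)).symm).reindex expoEquiv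

theorem monoBasis_apply (i j : ℕ) : monoBasis K (i, j) = X K ^ i * Y K ^ j := by
  simp only [monoBasis, Module.Basis.reindex_apply, Module.Basis.map_apply]
  rw [LinearEquiv.symm_apply_eq, LinearEquiv.ofBijective_apply, Psi_monomial]
  simp [expoEquiv, expo, MvPolynomial.X_pow_eq_monomial, MvPolynomial.monomial_mul]

/-- The coefficient of `X ^ i * Y ^ j` in an element of the Weyl algebra. -/
noncomputable def cf (i j : ℕ) : Weyl K →ₗ[K] K := (monoBasis K).coord (i, j)

theorem cf_mono (i j k l : ℕ) :
    cf i j (X K ^ k * Y K ^ l) = if k = i ∧ l = j then 1 else 0 := by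
  rw [cf, ← monoBasis_apply, Module.Basis.coord_apply, Module.Basis.repr_self,
    Finsupp.single_apply]
  simp [Prod.ext_iff]

theorem coeff_Psi (P : Weyl K) (s : Fin 2 →₀ ℕ) : (Psi K P).coeff s = cf (s 0) (s 1) P := by
  have : MvPolynomial.lcoeff K s ∘ₗ Psi K = cf (s 0) (s 1) := by
    apply (monoBasis K).ext
    rintro ⟨i, j⟩
    rw [monoBasis_apply, cf_mono, LinearMap.comp_apply, Psi_monomial]
    simp only [MvPolynomial.X_pow_eq_monomial, MvPolynomial.monomial_mul,
      MvPolynomial.lcoeff_apply, MvPolynomial.coeff_monomial, mul_one]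
    congr 1
    refine propext ⟨?_, ?_⟩
    · rintro rfl; simp
    · rintro ⟨rfl, rfl⟩; ext k; fin_cases k <;> simp
  exact DFunLike.congr_fun this P

theorem mem_supp {P : Weyl K} {z : ℤ × ℤ} :
    z ∈ supp P ↔ ∃ i j : ℕ, z = ((i : ℤ), (j : ℤ)) ∧ cf i j P ≠ 0 := by
  simp only [supp, polySupp, Finset.mem_image, MvPolynomial.mem_support_iff, coeff_Psi, point]
  constructor
  · rintro ⟨s, hs, rfl⟩; exact ⟨s 0, s 1, rfl, hs⟩
  · rintro ⟨i, j, rfl, h⟩; exact ⟨expo (i, j), by simpa [expo] using h, by simp [expo]⟩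

theorem ext_cf {P Q : Weyl K} (h : ∀ i j, cf i j P = cf i j Q) : P = Q :=
  (monoBasis K).ext_elem fun ⟨i, j⟩ => h i j

/-- The elements of `(ρ, σ)`-degree at most `m`. -/
noncomputable def fil (ρ σ m : ℤ) : Submodule K (Weyl K) :=
  Submodule.span K (monoBasis K '' {p : ℕ × ℕ | ρ * p.1 + σ * p.2 ≤ m})

theorem mem_fil {ρ σ m : ℤ} {P : Weyl K} :
    P ∈ fil ρ σ m ↔ ∀ i j : ℕ, cf i j P ≠ 0 → ρ * i + σ * j ≤ m := by
  rw [fil, Module.Basis.mem_span_image]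
  constructor
  · intro h i j hij
    exact @h (i, j) (by simpa [cf] using hij)
  · rintro h ⟨i, j⟩ hij
    exact h i j (by simpa [cf] using hij)

theorem fil_mono {ρ σ m n : ℤ} (h : m ≤ n) {P : Weyl K} (hP : P ∈ fil ρ σ m) : P ∈ fil ρ σ n :=
  mem_fil.2 fun i j hij => (mem_fil.1 hP i j hij).trans h

theorem mono_mem_fil {ρ σ m : ℤ} {i j : ℕ} (h : ρ * i + σ * j ≤ m) :
    X K ^ i * Y K ^ j ∈ fil ρ σ m := by
  rw [← monoBasis_apply]
  exact Submodule.subset_span ⟨(i, j), h, rfl⟩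

theorem fil_induction {ρ σ m : ℤ} {p : Weyl K → Prop} {P : Weyl K} (hP : P ∈ fil ρ σ m)
    (mono : ∀ i j : ℕ, ρ * i + σ * j ≤ m → p (X K ^ i * Y K ^ j)) (zero : p 0)
    (add : ∀ A B, p A → p B → p (A + B)) (smul : ∀ (c : K) A, p A → p (c • A)) : p P := by
  induction hP using Submodule.span_induction with
  | mem x h => obtain ⟨⟨i, j⟩, hij, rfl⟩ := h; rw [monoBasis_apply]; exact mono i j hij
  | zero => exact zero
  | add _ _ _ _ h1 h2 => exact add _ _ h1 h2
  | smul c _ _ h => exact smul c _ h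

/-- The dehomogenised component of `(ρ, σ)`-degree `m`: the sum of `a_{ij} t ^ j` over
`ρ i + σ j = m`. -/
noncomputable def top (ρ σ m : ℤ) : Weyl K →ₗ[K] Polynomial K :=
  (monoBasis K).constr K fun p => if ρ * p.1 + σ * p.2 = m then Polynomial.X ^ p.2 else 0

theorem top_mono (ρ σ m : ℤ) (i j : ℕ) :
    top ρ σ m (X K ^ i * Y K ^ j) = if ρ * i + σ * j = m then Polynomial.X ^ j else 0 := by
  rw [top, ← monoBasis_apply, Module.Basis.constr_basis]

/-- With $\rho\ne0$ the weight equation determines $i$ from $j$, so setting $x=1$ loses no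
information about a homogeneous component. -/
theorem coeff_top {ρ σ m : ℤ} (hρ : ρ ≠ 0) {i j : ℕ} (h : ρ * i + σ * j = m) (P : Weyl K) :
    (top ρ σ m P).coeff j = cf i j P := by
  have : Polynomial.lcoeff K j ∘ₗ top ρ σ m = cf i j := by
    apply (monoBasis K).ext
    rintro ⟨k, l⟩
    rw [monoBasis_apply, cf_mono, LinearMap.comp_apply, top_mono]
    by_cases hl : l = j
    · subst hl
      by_cases hk : k = i
      · subst hk; simp [h]
      · have : ρ * k + σ * l ≠ m := by
          intro h'
          have : ρ * (k : ℤ) = ρ * i := by linarith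
          exact hk (by exact_mod_cast mul_left_cancel₀ hρ this)
        simp [this, hk]
    · split_ifs <;> simp_all [Polynomial.coeff_X_pow, eq_comm]
  exact DFunLike.congr_fun this P

theorem exists_of_coeff_top_ne {ρ σ m : ℤ} {P : Weyl K} {j : ℕ} (h : (top ρ σ m P).coeff j ≠ 0) :
    ∃ i : ℕ, ρ * i + σ * j = m := by
  by_contra! hc
  apply h
  have : Polynomial.lcoeff K j ∘ₗ top ρ σ m = 0 := by
    apply (monoBasis K).ext
    rintro ⟨k, l⟩
    rw [monoBasis_apply, LinearMap.comp_apply, top_mono]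
    by_cases hl : l = j
    · subst hl; simp [hc k]
    · split_ifs <;> simp [Polynomial.coeff_X_pow, Ne.symm hl]
  exact DFunLike.congr_fun this P

theorem top_eq_zero_of_mem_fil {ρ σ m n : ℤ} (h : m < n) {P : Weyl K} (hP : P ∈ fil ρ σ m) :
    top ρ σ n P = 0 := by
  refine fil_induction hP (p := fun P => top ρ σ n P = 0) ?_ (map_zero _) ?_ ?_
  · intro i j hij; rw [top_mono, if_neg (by omega)]
  · intro A B hA hB; rw [map_add, hA, hB, add_zero]
  · intro c A hA; rw [map_smul, hA, smul_zero]

theorem mem_fil_sub_one {ρ σ m : ℤ} (hρ : ρ ≠ 0) {P : Weyl K} (hP : P ∈ fil ρ σ m)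
    (h : top ρ σ m P = 0) : P ∈ fil ρ σ (m - 1) := by
  refine mem_fil.2 fun i j hij => ?_
  have h1 := mem_fil.1 hP i j hij
  rcases h1.lt_or_eq with h2 | h2
  · omega
  · rw [← coeff_top hρ h2, h] at hij; simp at hij

/-! ### Normal ordering of monomials. -/

theorem Y_mul_X_pow' (k : ℕ) :
    Y K * X K ^ k = X K ^ k * Y K + (k : K) • X K ^ (k - 1) := by
  cases k with
  | zero => simp
  | succ k => rw [Y_mul_X_pow]; simp

theorem Y_mul_mono (k l : ℕ) : Y K * (X K ^ k * Y K ^ l) =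
    X K ^ k * Y K ^ (l + 1) + (k : K) • (X K ^ (k - 1) * Y K ^ l) := by
  rw [← mul_assoc, Y_mul_X_pow', add_mul, mul_assoc, ← pow_succ', smul_mul_assoc]

/-- The degree bound is demanded only for a nonzero coefficient: truncated exponents such as $0-1$
always come with coefficient zero. -/
theorem smul_mono_mem_fil {ρ σ m : ℤ} {i j : ℕ} {c : K} (h : c ≠ 0 → ρ * i + σ * j ≤ m) :
    c • (X K ^ i * Y K ^ j) ∈ fil ρ σ m := by
  by_cases hc : c = 0
  · simp [hc]
  · exact Submodule.smul_mem _ _ (mono_mem_fil (h hc))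

theorem Y_mul_mem_fil {ρ σ m : ℤ} (hρσ : 0 < ρ + σ) {P : Weyl K} (hP : P ∈ fil ρ σ m) :
    Y K * P ∈ fil ρ σ (m + σ) := by
  refine fil_induction hP (p := fun P => Y K * P ∈ fil ρ σ (m + σ)) ?_ (by simp) ?_ ?_
  · intro i j hij
    rw [Y_mul_mono]
    refine add_mem (mono_mem_fil (by push_cast; linarith)) (smul_mono_mem_fil fun hc => ?_)
    obtain ⟨i, rfl⟩ : ∃ i', i = i' + 1 := ⟨i - 1, by have : i ≠ 0 := (by rintro rfl; simp at hc); omega⟩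
    push_cast at hij
    simp only [Nat.add_sub_cancel]
    linarith
  · intro A B hA hB; rw [mul_add]; exact add_mem hA hB
  · intro c A hA; rw [mul_smul_comm]; exact Submodule.smul_mem _ _ hA

/-- These are the first two terms of normal ordering. Each contraction of a $Y$ with an $X$ costs
$\rho+\sigma$ in degree, so the remainder is at least two contractions down. -/
theorem Y_pow_mul_X_pow {ρ σ : ℤ} (hρσ : 0 < ρ + σ) (j k : ℕ) :
    Y K ^ j * X K ^ k - X K ^ k * Y K ^ j - (j * k : K) • (X K ^ (k - 1) * Y K ^ (j - 1)) ∈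
      fil ρ σ (ρ * k + σ * j - 2 * (ρ + σ)) := by
  induction j with
  | zero => simp
  | succ j ih =>
    have h1 := Y_mul_mem_fil hρσ ih
    -- Moving the new $Y$ past $X^{k-1}$ in the correction term produces this doubly contracted
    -- term, which belongs to the remainder.
    have h2 : (j * k * (k - 1 : ℕ) : K) • (X K ^ (k - 1 - 1) * Y K ^ (j - 1)) ∈
        fil ρ σ (ρ * k + σ * (j + 1 : ℕ) - 2 * (ρ + σ)) := by
      refine smul_mono_mem_fil fun hc => ?_
      have hj : j ≠ 0 := by rintro rfl; simp at hc
      have hk : k ≠ 0 := by rintro rfl; simp at hc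
      have hk1 : k ≠ 1 := by rintro rfl; simp at hc
      obtain ⟨j, rfl⟩ : ∃ i', j = i' + 1 := ⟨j - 1, by omega⟩
      obtain ⟨k, rfl⟩ : ∃ i', k = i' + 2 := ⟨k - 2, by omega⟩
      simp only [Nat.add_sub_cancel, show k + 2 - 1 - 1 = k by omega]
      push_cast
      linarith
    have h3 := add_mem (fil_mono (n := ρ * k + σ * (j + 1 : ℕ) - 2 * (ρ + σ))
      (by push_cast; linarith) h1) h2
    convert h3 using 1
    have e1 := Y_mul_mono (K := K) k j
    have e2 := Y_mul_mono (K := K) (k - 1) (j - 1)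
    rw [mul_sub, mul_sub, mul_smul_comm, e1, e2, pow_succ', mul_assoc, Nat.add_sub_cancel]
    rcases j with _ | j
    · simp [sub_sub]
    · simp only [Nat.add_sub_cancel]
      push_cast
      module

theorem mul_mem_fil_aux {ρ σ : ℤ} (i j : ℕ) {m : ℤ} {P : Weyl K}
    (hP : P ∈ fil ρ σ m) : X K ^ i * P * Y K ^ j ∈ fil ρ σ (ρ * i + σ * j + m) := by
  refine fil_induction hP (p := fun P => X K ^ i * P * Y K ^ j ∈ fil ρ σ (ρ * i + σ * j + m))
    ?_ (by simp) ?_ ?_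
  · intro k l hkl
    rw [← mul_assoc, ← pow_add, mul_assoc, ← pow_add]
    exact mono_mem_fil (by push_cast; linarith)
  · intro A B hA hB; rw [mul_add, add_mul]; exact add_mem hA hB
  · intro c A hA; rw [mul_smul_comm, smul_mul_assoc]; exact Submodule.smul_mem _ _ hA

theorem mono_mul_mono {ρ σ : ℤ} (hρσ : 0 < ρ + σ) (i j k l : ℕ) :
    (X K ^ i * Y K ^ j) * (X K ^ k * Y K ^ l) - X K ^ (i + k) * Y K ^ (j + l)
      - (j * k : K) • (X K ^ (i + k - 1) * Y K ^ (j + l - 1)) ∈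
      fil ρ σ (ρ * i + σ * j + (ρ * k + σ * l) - 2 * (ρ + σ)) := by
  have h := mul_mem_fil_aux i l (Y_pow_mul_X_pow (K := K) hρσ j k)
  refine fil_mono (m := ρ * i + σ * l + (ρ * k + σ * j - 2 * (ρ + σ))) (by linarith) ?_
  convert h using 1
  by_cases hjk : j = 0 ∨ k = 0
  · rcases hjk with rfl | rfl <;> simp [pow_add, mul_assoc]
  · have e1 : i + k - 1 = i + (k - 1) := by omega
    have e2 : j + l - 1 = (j - 1) + l := by omega
    rw [e1, e2]
    simp only [mul_sub, sub_mul, pow_add, mul_smul_comm, smul_mul_assoc, mul_assoc]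

end Dixmier

/-! ### Leading components of products and commutators. -/

namespace Dixmier

variable {K : Type*} [Field K]

theorem mono_mul_mono_sub {ρ σ : ℤ} (hρσ : 0 < ρ + σ) (i j k l : ℕ) :
    (X K ^ i * Y K ^ j) * (X K ^ k * Y K ^ l) - X K ^ (i + k) * Y K ^ (j + l) ∈
      fil ρ σ (ρ * i + σ * j + (ρ * k + σ * l) - (ρ + σ)) := by
  have h := fil_mono (n := ρ * i + σ * j + (ρ * k + σ * l) - (ρ + σ)) (by linarith)
    (mono_mul_mono (K := K) hρσ i j k l)
  have h2 : (j * k : K) • (X K ^ (i + k - 1) * Y K ^ (j + l - 1)) ∈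
      fil ρ σ (ρ * i + σ * j + (ρ * k + σ * l) - (ρ + σ)) := by
    refine smul_mono_mem_fil fun hc => ?_
    have hj : j ≠ 0 := by rintro rfl; simp at hc
    have hk : k ≠ 0 := by rintro rfl; simp at hc
    rw [Nat.cast_sub (by omega), Nat.cast_sub (by omega)]
    push_cast
    linarith
  simpa using add_mem h h2

theorem mul_aux {ρ σ m n : ℤ} (hρσ : 0 < ρ + σ) {P Q : Weyl K} (hP : P ∈ fil ρ σ m)
    (hQ : Q ∈ fil ρ σ n) : P * Q ∈ fil ρ σ (m + n) ∧
      top ρ σ (m + n) (P * Q) = top ρ σ m P * top ρ σ n Q := by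
  refine fil_induction hP (p := fun P => P * Q ∈ fil ρ σ (m + n) ∧
      top ρ σ (m + n) (P * Q) = top ρ σ m P * top ρ σ n Q) ?_ (by simp) ?_ ?_
  · intro i j hij
    refine fil_induction hQ (p := fun Q => (X K ^ i * Y K ^ j) * Q ∈ fil ρ σ (m + n) ∧
      top ρ σ (m + n) ((X K ^ i * Y K ^ j) * Q) = top ρ σ m (X K ^ i * Y K ^ j) * top ρ σ n Q)
      ?_ (by simp) ?_ ?_
    · intro k l hkl
      have h := mono_mul_mono_sub (K := K) hρσ i j k l
      have hm : X K ^ (i + k) * Y K ^ (j + l) ∈ fil ρ σ (m + n) :=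
        mono_mem_fil (by push_cast; linarith)
      constructor
      · have := add_mem (fil_mono (n := m + n) (by linarith) h) hm
        simpa using this
      · have h0 := top_eq_zero_of_mem_fil (n := m + n) (by linarith) h
        rw [map_sub, sub_eq_zero] at h0
        rw [h0, top_mono, top_mono, top_mono]
        push_cast
        by_cases h1 : ρ * i + σ * j = m
        · by_cases h2 : ρ * k + σ * l = n
          · rw [if_pos (by linarith), if_pos h1, if_pos h2, pow_add]
          · rw [if_neg (fun h => h2 (by linarith)), if_neg h2, mul_zero]
        · have : ρ * i + σ * j < m := lt_of_le_of_ne hij h1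
          rw [if_neg (fun h => by linarith), if_neg h1, zero_mul]
    · rintro A B ⟨hA, hA'⟩ ⟨hB, hB'⟩
      simp only [mul_add, map_add, hA', hB', and_true]
      exact add_mem hA hB
    · rintro c A ⟨hA, hA'⟩
      simp only [mul_smul_comm, map_smul, hA', and_true]
      exact Submodule.smul_mem _ _ hA
  · rintro A B ⟨hA, hA'⟩ ⟨hB, hB'⟩
    simp only [add_mul, map_add, hA', hB', and_true]
    exact add_mem hA hB
  · rintro c A ⟨hA, hA'⟩
    simp only [smul_mul_assoc, map_smul, hA', and_true]
    exact Submodule.smul_mem _ _ hA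

theorem mul_mem_fil {ρ σ m n : ℤ} (hρσ : 0 < ρ + σ) {P Q : Weyl K} (hP : P ∈ fil ρ σ m)
    (hQ : Q ∈ fil ρ σ n) : P * Q ∈ fil ρ σ (m + n) := (mul_aux hρσ hP hQ).1

theorem top_mul {ρ σ m n : ℤ} (hρσ : 0 < ρ + σ) {P Q : Weyl K} (hP : P ∈ fil ρ σ m)
    (hQ : Q ∈ fil ρ σ n) : top ρ σ (m + n) (P * Q) = top ρ σ m P * top ρ σ n Q :=
  (mul_aux hρσ hP hQ).2

theorem one_mem_fil (ρ σ : ℤ) : (1 : Weyl K) ∈ fil ρ σ 0 := by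
  simpa using mono_mem_fil (K := K) (ρ := ρ) (σ := σ) (m := 0) (i := 0) (j := 0) (by simp)

theorem top_one (ρ σ : ℤ) : top ρ σ 0 (1 : Weyl K) = 1 := by
  simpa using top_mono (K := K) ρ σ 0 0 0

theorem pow_mem_fil {ρ σ m : ℤ} (hρσ : 0 < ρ + σ) {P : Weyl K} (hP : P ∈ fil ρ σ m) (n : ℕ) :
    P ^ n ∈ fil ρ σ (n * m) ∧ top ρ σ (n * m) (P ^ n) = top ρ σ m P ^ n := by
  induction n with
  | zero => simp [one_mem_fil, top_one]
  | succ n ih =>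
    have e : ((n + 1 : ℕ) : ℤ) * m = n * m + m := by push_cast; ring
    rw [pow_succ, pow_succ, e, top_mul hρσ ih.1 hP, ih.2]
    exact ⟨mul_mem_fil hρσ ih.1 hP, rfl⟩

/-- The leading part of $[P,Q]$ is $P_yQ_x-P_xQ_y$. Multiplying by $\rho x$ and eliminating $\rho
xP_x$ and $\rho xQ_x$ by Euler's relation gives $nQP_y-mPQ_y$; then $x=1$. -/
theorem comm_aux {ρ σ m n : ℤ} (hρσ : 0 < ρ + σ) {P Q : Weyl K} (hP : P ∈ fil ρ σ m)
    (hQ : Q ∈ fil ρ σ n) : P * Q - Q * P ∈ fil ρ σ (m + n - (ρ + σ)) ∧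
      (ρ : K) • top ρ σ (m + n - (ρ + σ)) (P * Q - Q * P) =
        (n : K) • (top ρ σ n Q * (top ρ σ m P).derivative) -
          (m : K) • (top ρ σ m P * (top ρ σ n Q).derivative) := by
  refine fil_induction hP (p := fun P => P * Q - Q * P ∈ fil ρ σ (m + n - (ρ + σ)) ∧
      (ρ : K) • top ρ σ (m + n - (ρ + σ)) (P * Q - Q * P) =
        (n : K) • (top ρ σ n Q * (top ρ σ m P).derivative) -
          (m : K) • (top ρ σ m P * (top ρ σ n Q).derivative)) ?_ (by simp) ?_ ?_
  · intro i j hij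
    refine fil_induction hQ (p := fun Q => (X K ^ i * Y K ^ j) * Q - Q * (X K ^ i * Y K ^ j) ∈
      fil ρ σ (m + n - (ρ + σ)) ∧ (ρ : K) • top ρ σ (m + n - (ρ + σ))
        ((X K ^ i * Y K ^ j) * Q - Q * (X K ^ i * Y K ^ j)) =
        (n : K) • (top ρ σ n Q * (top ρ σ m (X K ^ i * Y K ^ j)).derivative) -
          (m : K) • (top ρ σ m (X K ^ i * Y K ^ j) * (top ρ σ n Q).derivative)) ?_ (by simp) ?_ ?_
    · intro k l hkl
      have h1 := mono_mul_mono (K := K) hρσ i j k l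
      have h2 := mono_mul_mono (K := K) hρσ k l i j
      rw [add_comm (ρ * (k : ℤ) + _), add_comm k, add_comm l] at h2
      have h := sub_mem h1 h2
      set Z := (X K ^ i * Y K ^ j) * (X K ^ k * Y K ^ l) -
        (X K ^ k * Y K ^ l) * (X K ^ i * Y K ^ j) with hZ
      set M := ((j * k - l * i : K)) • (X K ^ (i + k - 1) * Y K ^ (j + l - 1)) with hM
      have e : ∀ a b c d : Weyl K, ∀ x y : K, a - b - x • c - (d - b - y • c) =
        (a - d) - (x - y) • c := by intros; module
      rw [e, ← hZ, ← hM] at h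
      have hpos : (j * k - l * i : K) ≠ 0 → 1 ≤ i + k ∧ 1 ≤ j + l := by
        intro hc
        refine ⟨?_, ?_⟩ <;> by_contra hh
        · have : i = 0 := by omega
          have : k = 0 := by omega
          subst_vars; simp at hc
        · have : j = 0 := by omega
          have : l = 0 := by omega
          subst_vars; simp at hc
      have hMf : M ∈ fil ρ σ (m + n - (ρ + σ)) := by
        refine smul_mono_mem_fil fun hc => ?_
        obtain ⟨h3, h4⟩ := hpos hc
        rw [Nat.cast_sub h3, Nat.cast_sub h4]
        push_cast
        linarith
      constructor
      · simpa using add_mem (fil_mono (n := m + n - (ρ + σ)) (by linarith) h) hMf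
      · have h0 := top_eq_zero_of_mem_fil (n := m + n - (ρ + σ)) (by linarith) h
        rw [map_sub, sub_eq_zero] at h0
        rw [h0, hM, map_smul, top_mono, top_mono, top_mono]
        by_cases h1 : ρ * i + σ * j = m
        · by_cases h2 : ρ * k + σ * l = n
          · rw [if_pos h1, if_pos h2]
            -- Euler's relation on monomials: it turns the Poisson coefficient $jk-li$ into one
            -- depending only on degrees and $y$-exponents.
            have key : (ρ : K) * (j * k - l * i) = n * j - m * l := by
              rw [← h1, ← h2]; push_cast; ring
            have hd : (Polynomial.X ^ l * Polynomial.derivative (Polynomial.X ^ j) :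
                Polynomial K) = (j : K) • Polynomial.X ^ (j + l - 1) := by
              rcases j with _ | j
              · simp
              · rw [Polynomial.derivative_X_pow, Polynomial.smul_eq_C_mul,
                  show j + 1 + l - 1 = l + j by omega, pow_add]
                simp only [Nat.add_sub_cancel]
                ring
            have hd' : (Polynomial.X ^ j * Polynomial.derivative (Polynomial.X ^ l) :
                Polynomial K) = (l : K) • Polynomial.X ^ (j + l - 1) := by
              rcases l with _ | l
              · simp
              · rw [Polynomial.derivative_X_pow, Polynomial.smul_eq_C_mul,
                  show j + (l + 1) - 1 = j + l by omega, pow_add]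
                simp only [Nat.add_sub_cancel]
                ring
            rw [hd, hd', smul_smul, smul_smul, smul_smul, ← sub_smul, key.symm]
            by_cases hc : (j * k - l * i : K) = 0
            · simp [hc]
            · obtain ⟨h3, h4⟩ := hpos hc
              rw [if_pos]
              rw [Nat.cast_sub h3, Nat.cast_sub h4]
              push_cast
              linarith
          · have : ρ * k + σ * l < n := lt_of_le_of_ne hkl h2
            by_cases hc : (j * k - l * i : K) = 0
            · simp [hc, h2]
            · obtain ⟨h3, h4⟩ := hpos hc
              rw [if_neg, if_neg h2]
              · simp
              rw [Nat.cast_sub h3, Nat.cast_sub h4]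
              push_cast
              exact fun hh => by linarith
        · have : ρ * i + σ * j < m := lt_of_le_of_ne hij h1
          by_cases hc : (j * k - l * i : K) = 0
          · simp [hc, h1]
          · obtain ⟨h3, h4⟩ := hpos hc
            rw [if_neg, if_neg h1]
            · simp
            rw [Nat.cast_sub h3, Nat.cast_sub h4]
            push_cast
            exact fun hh => by linarith
    · rintro A B ⟨hA, hA'⟩ ⟨hB, hB'⟩
      have e : (X K ^ i * Y K ^ j) * (A + B) - (A + B) * (X K ^ i * Y K ^ j) =
        ((X K ^ i * Y K ^ j) * A - A * (X K ^ i * Y K ^ j)) +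
          ((X K ^ i * Y K ^ j) * B - B * (X K ^ i * Y K ^ j)) := by
        rw [mul_add, add_mul]; abel
      rw [e, map_add, smul_add, hA', hB']
      refine ⟨add_mem hA hB, ?_⟩
      simp only [map_add, add_mul, mul_add, smul_add]
      abel
    · rintro c A ⟨hA, hA'⟩
      have e : (X K ^ i * Y K ^ j) * (c • A) - (c • A) * (X K ^ i * Y K ^ j) =
        c • ((X K ^ i * Y K ^ j) * A - A * (X K ^ i * Y K ^ j)) := by
        rw [mul_smul_comm, smul_mul_assoc, smul_sub]
      rw [e, map_smul, smul_comm, hA']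
      refine ⟨Submodule.smul_mem _ _ hA, ?_⟩
      simp only [map_smul, smul_mul_assoc, mul_smul_comm, smul_sub]
      rw [smul_comm c, smul_comm c]
  · rintro A B ⟨hA, hA'⟩ ⟨hB, hB'⟩
    have e : (A + B) * Q - Q * (A + B) = (A * Q - Q * A) + (B * Q - Q * B) := by
      rw [mul_add, add_mul]; abel
    rw [e, map_add, smul_add, hA', hB']
    refine ⟨add_mem hA hB, ?_⟩
    simp only [map_add, add_mul, mul_add, smul_add]
    abel
  · rintro c A ⟨hA, hA'⟩
    have e : (c • A) * Q - Q * (c • A) = c • (A * Q - Q * A) := by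
      rw [mul_smul_comm, smul_mul_assoc, smul_sub]
    rw [e, map_smul, smul_comm, hA']
    refine ⟨Submodule.smul_mem _ _ hA, ?_⟩
    simp only [map_smul, smul_mul_assoc, mul_smul_comm, smul_sub]
    rw [smul_comm c, smul_comm c]

theorem comm_mem_fil {ρ σ m n : ℤ} (hρσ : 0 < ρ + σ) {P Q : Weyl K} (hP : P ∈ fil ρ σ m)
    (hQ : Q ∈ fil ρ σ n) : P * Q - Q * P ∈ fil ρ σ (m + n - (ρ + σ)) := (comm_aux hρσ hP hQ).1

theorem top_comm {ρ σ m n : ℤ} (hρσ : 0 < ρ + σ) {P Q : Weyl K} (hP : P ∈ fil ρ σ m)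
    (hQ : Q ∈ fil ρ σ n) : (ρ : K) • top ρ σ (m + n - (ρ + σ)) (P * Q - Q * P) =
        (n : K) • (top ρ σ n Q * (top ρ σ m P).derivative) -
          (m : K) • (top ρ σ m P * (top ρ σ n Q).derivative) := (comm_aux hρσ hP hQ).2

end Dixmier

/-! ### Logarithmic derivatives of one-variable polynomials. -/

namespace Dixmier

open Polynomial (C derivative)

section OneVariable

variable {K : Type*} [Field K]

theorem coeff_X_mul_derivative (f : Polynomial K) (n : ℕ) :
    (Polynomial.X * derivative f).coeff n = n * f.coeff n := by
  cases n with
  | zero => simp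
  | succ n => rw [Polynomial.coeff_X_mul, Polynomial.coeff_derivative]; push_cast; ring

theorem natDegree_X_mul_derivative_le (f : Polynomial K) :
    (Polynomial.X * derivative f).natDegree ≤ f.natDegree := by
  rw [Polynomial.natDegree_le_iff_coeff_eq_zero]
  intro n hn
  rw [coeff_X_mul_derivative, Polynomial.coeff_eq_zero_of_natDegree_lt hn, mul_zero]

theorem coeff_mul_X_mul_derivative (f g : Polynomial K) :
    (g * (Polynomial.X * derivative f)).coeff (g.natDegree + f.natDegree) =
      f.natDegree * (g.leadingCoeff * f.leadingCoeff) := by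
  rw [Polynomial.coeff_mul_add_eq_of_natDegree_le le_rfl (natDegree_X_mul_derivative_le f),
    coeff_X_mul_derivative, Polynomial.leadingCoeff, Polynomial.leadingCoeff]
  ring

variable [CharZero K]

/-- After multiplication by $t$, the top coefficients are the degrees times the same product of
leading coefficients; characteristic $0$ lets them be compared. -/
theorem natDegree_eq_of_wronskian {f g : Polynomial K} (hf : f ≠ 0) (hg : g ≠ 0)
    (h : derivative f * g = f * derivative g) : f.natDegree = g.natDegree := by
  have h1 : g * (Polynomial.X * derivative f) = f * (Polynomial.X * derivative g) := by
    linear_combination Polynomial.X * h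
  have h2 := congrArg (fun p => p.coeff (g.natDegree + f.natDegree)) h1
  beta_reduce at h2
  rw [coeff_mul_X_mul_derivative, add_comm, coeff_mul_X_mul_derivative,
    mul_comm f.leadingCoeff] at h2
  have h3 := mul_right_cancel₀ (mul_ne_zero (Polynomial.leadingCoeff_ne_zero.2 hg)
    (Polynomial.leadingCoeff_ne_zero.2 hf)) h2
  exact_mod_cast h3

/-- Subtracting the multiple of $g$ that cancels the leading term of $f$ preserves the relation but
lowers the degree, so the difference must vanish. -/
theorem proportional_of_wronskian {f g : Polynomial K} (hf : f ≠ 0) (hg : g ≠ 0)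
    (h : derivative f * g = f * derivative g) : ∃ c : K, c ≠ 0 ∧ f = C c * g := by
  have hd := natDegree_eq_of_wronskian hf hg h
  have hlf := Polynomial.leadingCoeff_ne_zero.2 hf
  have hlg := Polynomial.leadingCoeff_ne_zero.2 hg
  set c := f.leadingCoeff / g.leadingCoeff with hc
  have hc0 : c ≠ 0 := div_ne_zero hlf hlg
  refine ⟨c, hc0, ?_⟩
  by_contra hne
  have hr : f - C c * g ≠ 0 := sub_ne_zero.2 hne
  have hlt : (f - C c * g).degree < f.degree := by
    apply Polynomial.degree_sub_lt_left _ hf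
    · rw [Polynomial.leadingCoeff_mul, Polynomial.leadingCoeff_C, hc, div_mul_cancel₀ _ hlg]
    · rw [Polynomial.degree_C_mul hc0, Polynomial.degree_eq_natDegree hf,
        Polynomial.degree_eq_natDegree hg, hd]
  have hW : derivative (f - C c * g) * g = (f - C c * g) * derivative g := by
    simp only [map_sub, Polynomial.derivative_mul, Polynomial.derivative_C]
    linear_combination h
  have := natDegree_eq_of_wronskian hr hg hW
  rw [Polynomial.degree_eq_natDegree hr, Polynomial.degree_eq_natDegree hf, hd, this] at hlt
  exact lt_irrefl _ hlt

theorem derivative_pow_mul_self (f : Polynomial K) (n : ℕ) :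
    derivative (f ^ n) * f = (n : Polynomial K) * (f ^ n * derivative f) := by
  cases n with
  | zero => simp
  | succ n =>
    rw [Polynomial.derivative_pow, Nat.add_sub_cancel]
    simp only [map_natCast]
    ring

/-- The hypothesis reads $n f'/f = v\,g'/g$, so $g^v/f^n$ has zero logarithmic derivative. -/
theorem pow_proportional {f g : Polynomial K} (hf : f ≠ 0) (hg : g ≠ 0) {v n : ℤ} (hv : 0 ≤ v)
    (hn : 0 ≤ n) (h : (n : K) • (g * derivative f) = (v : K) • (f * derivative g)) :
    ∃ c : K, c ≠ 0 ∧ g ^ v.toNat = C c * f ^ n.toNat := by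
  obtain ⟨v, rfl⟩ := Int.eq_ofNat_of_zero_le hv
  obtain ⟨n, rfl⟩ := Int.eq_ofNat_of_zero_le hn
  simp only [Int.toNat_natCast]
  apply proportional_of_wronskian (pow_ne_zero _ hg) (pow_ne_zero _ hf)
  apply mul_right_cancel₀ (mul_ne_zero hg hf)
  simp only [Polynomial.smul_eq_C_mul, Int.cast_natCast, map_natCast] at h
  linear_combination (f ^ n * f) * derivative_pow_mul_self g v -
    (g ^ v * g) * derivative_pow_mul_self f n - (g ^ v * f ^ n) * h

end OneVariable

/-! ### Degrees, and a companion whose leading form does not Poisson-commute with that of $P$. -/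

variable {K : Type*} [Field K]

/-- `P` is nonzero of `(ρ, σ)`-degree `m`. -/
def HasDeg (ρ σ : ℤ) (P : Weyl K) (m : ℤ) : Prop := P ∈ fil ρ σ m ∧ top ρ σ m P ≠ 0

theorem exists_coeff_ne {ρ σ m : ℤ} {P : Weyl K} (hρ : ρ ≠ 0) (h : top ρ σ m P ≠ 0) :
    ∃ i j : ℕ, ρ * i + σ * j = m ∧ cf i j P ≠ 0 := by
  obtain ⟨j, hj⟩ : ∃ j, (top ρ σ m P).coeff j ≠ 0 := by
    by_contra! hc
    exact h (Polynomial.ext (by simpa using hc))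
  obtain ⟨i, hi⟩ := exists_of_coeff_top_ne hj
  exact ⟨i, j, hi, by rwa [coeff_top hρ hi] at hj⟩

theorem top_ne_zero {ρ σ m : ℤ} {P : Weyl K} (hρ : ρ ≠ 0) {i j : ℕ} (h : ρ * i + σ * j = m)
    (hc : cf i j P ≠ 0) : top ρ σ m P ≠ 0 := by
  intro h0
  rw [← coeff_top hρ h, h0] at hc
  simp at hc

theorem exists_cf_ne {P : Weyl K} (hP : P ≠ 0) : ∃ i j, cf i j P ≠ 0 := by
  by_contra! hc
  exact hP (ext_cf fun i j => by rw [hc, map_zero])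

theorem exists_hasDeg {ρ : ℤ} (hρ : ρ ≠ 0) (σ : ℤ) {P : Weyl K} (hP : P ≠ 0) :
    ∃ m, HasDeg ρ σ P m := by
  obtain ⟨i, j, hij⟩ := exists_cf_ne hP
  obtain ⟨p, hp, hmax⟩ := Finset.exists_max_image ((monoBasis K).repr P).support
    (fun p : ℕ × ℕ => ρ * (p.1 : ℤ) + σ * p.2) ⟨(i, j), by simpa [cf] using hij⟩
  refine ⟨ρ * p.1 + σ * p.2, mem_fil.2 fun i j hij => ?_, top_ne_zero hρ rfl ?_⟩
  · exact hmax (i, j) (by simpa [cf] using hij)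
  · simpa [cf] using hp

theorem HasDeg.ne_zero {ρ σ m : ℤ} {P : Weyl K} (h : HasDeg ρ σ P m) : P ≠ 0 := by
  rintro rfl; exact h.2 (map_zero _)

theorem HasDeg.le {ρ σ m n : ℤ} {P : Weyl K} (h : HasDeg ρ σ P m) (hP : P ∈ fil ρ σ n) :
    m ≤ n := by
  by_contra! hlt
  exact h.2 (top_eq_zero_of_mem_fil hlt hP)

theorem HasDeg.unique {ρ σ m n : ℤ} {P : Weyl K} (h : HasDeg ρ σ P m) (h' : HasDeg ρ σ P n) :
    m = n := le_antisymm (h.le h'.1) (h'.le h.1)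

theorem HasDeg.nonneg {ρ σ m : ℤ} (hρ : 0 < ρ) (hσ : 0 ≤ σ) {P : Weyl K}
    (h : HasDeg ρ σ P m) : 0 ≤ m := by
  obtain ⟨i, j, rfl, -⟩ := exists_coeff_ne hρ.ne' h.2
  positivity

theorem hasDeg_algebraMap (ρ σ : ℤ) {c : K} (hc : c ≠ 0) :
    HasDeg ρ σ (algebraMap K (Weyl K) c) 0 := by
  rw [Algebra.algebraMap_eq_smul_one]
  refine ⟨Submodule.smul_mem _ _ (one_mem_fil ρ σ), ?_⟩
  rw [map_smul, top_one]
  simpa using hc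

theorem hasDeg_iff {ρ σ m : ℤ} (hρ : ρ ≠ 0) {P : Weyl K} :
    HasDeg ρ σ P m ↔ P ∈ fil ρ σ m ∧ P ∉ fil ρ σ (m - 1) := by
  refine and_congr_right fun hP => ⟨fun h h' => ?_, fun h h' => h (mem_fil_sub_one hρ hP h')⟩
  exact h (top_eq_zero_of_mem_fil (by omega) h')

/-- Two elements whose commutator is a nonzero constant. -/
def CommConst (P Q : Weyl K) : Prop := ∃ c : K, c ≠ 0 ∧ P * Q - Q * P = algebraMap K (Weyl K) c

theorem CommConst.symm {P Q : Weyl K} (h : CommConst P Q) : CommConst Q P := by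
  obtain ⟨c, hc, h⟩ := h
  exact ⟨-c, neg_ne_zero.2 hc, by rw [map_neg, ← h]; abel⟩

theorem CommConst.ne_zero {P Q : Weyl K} (h : CommConst P Q) : P ≠ 0 := by
  rintro rfl
  obtain ⟨c, hc, h⟩ := h
  exact (hasDeg_algebraMap 0 0 hc).ne_zero (by simp [← h])

/-- The relation between leading components on which the arguments are based: `u` is, up to the
factor `ρ`, the Poisson bracket of the homogeneous elements `f` and `G` of degrees `V` and `N`, and
a power of `u` is a multiple of a power of `f`. -/
structure BracketData (ρ σ V N M : ℤ) (f G u : Polynomial K) : Prop where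
  f_ne : f ≠ 0
  G_ne : G ≠ 0
  u_ne : u ≠ 0
  M_eq : M = V + N - (ρ + σ)
  power : ∃ (p q : ℕ) (c : K), 0 < p ∧ (p : ℤ) * M = q * V ∧ u ^ p = C c * f ^ q
  bracket : (ρ : K) • u = (N : K) • (G * derivative f) - (V : K) • (f * derivative G)
  lattice_G : ∀ j, G.coeff j ≠ 0 → ∃ i : ℕ, ρ * i + σ * j = N
  lattice_u : ∀ j, u.coeff j ≠ 0 → ∃ i : ℕ, ρ * i + σ * j = M

theorem comm_pow {ρ σ N M : ℤ} (hρσ : 0 < ρ + σ) {P T : Weyl K} (hT : T ∈ fil ρ σ N)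
    (hC : P * T - T * P ∈ fil ρ σ M) (n : ℕ) :
    P * T ^ (n + 1) - T ^ (n + 1) * P ∈ fil ρ σ (n * N + M) ∧
      top ρ σ (n * N + M) (P * T ^ (n + 1) - T ^ (n + 1) * P) =
        ((n : K) + 1) • (top ρ σ N T ^ n * top ρ σ M (P * T - T * P)) := by
  induction n with
  | zero => simpa using hC
  | succ n ih =>
    have e : P * T ^ (n + 1 + 1) - T ^ (n + 1 + 1) * P =
        (P * T ^ (n + 1) - T ^ (n + 1) * P) * T + T ^ (n + 1) * (P * T - T * P) := by
      rw [pow_succ T (n + 1)]; simp only [mul_sub, sub_mul, mul_assoc]; abel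
    have h1 : ((n + 1 : ℕ) : ℤ) * N + M = (n * N + M) + N := by push_cast; ring
    have hp := pow_mem_fil hρσ hT (n + 1)
    rw [e]
    constructor
    · refine add_mem ?_ (mul_mem_fil hρσ hp.1 hC)
      rw [h1]; exact mul_mem_fil hρσ ih.1 hT
    · rw [map_add, top_mul hρσ hp.1 hC, h1, top_mul hρσ ih.1 hT, ih.2, hp.2]
      simp only [Polynomial.smul_eq_C_mul, map_add, map_natCast, map_one]
      push_cast
      ring

/-- Induction on the gap $g$ between the expected degree of $[P,T]$ and its actual degree $L$. Gap
zero means that the leading forms do not commute. Otherwise $T^V$ and a multiple of $P^N$ have the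
same leading form; subtracting that multiple does not affect the commutator with $P$, which is
$[P,T^V]$. -/
theorem exists_bracketData_aux [CharZero K] {ρ σ V : ℤ} (hρ : 0 < ρ) (hσ : 0 ≤ σ) (hV : 0 < V)
    {P : Weyl K} (hP : HasDeg ρ σ P V) (g : ℕ) : ∀ (T : Weyl K) (N L : ℤ), T ∈ fil ρ σ N →
    HasDeg ρ σ (P * T - T * P) L → (∃ (p q : ℕ) (c : K), 0 < p ∧ (p : ℤ) * L = q * V ∧
      top ρ σ L (P * T - T * P) ^ p = C c * top ρ σ V P ^ q) → V + N - (ρ + σ) - L = g →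
    ∃ (N M : ℤ) (G u : Polynomial K), BracketData ρ σ V N M (top ρ σ V P) G u := by
  have hρσ : 0 < ρ + σ := by omega
  induction g with
  | zero =>
    intro T N L hT hC hpow hg
    have hL : L = V + N - (ρ + σ) := by push_cast at hg; omega
    subst hL
    have hb := top_comm hρσ hP.1 hT
    refine ⟨N, _, top ρ σ N T, _, hP.2, ?_, hC.2, rfl, hpow, hb,
      fun j => exists_of_coeff_top_ne, fun j => exists_of_coeff_top_ne⟩
    intro h0
    rw [h0] at hb
    simp only [zero_mul, smul_zero, map_zero, mul_zero, sub_zero, smul_eq_zero] at hb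
    rcases hb with hb | hb
    · exact hρ.ne' (by exact_mod_cast hb)
    · exact hC.2 hb
  | succ g ih =>
    intro T N L hT hC hpow hg
    have hb := top_comm hρσ hP.1 hT
    rw [top_eq_zero_of_mem_fil (by push_cast at hg; omega) hC.1, smul_zero, eq_comm,
      sub_eq_zero] at hb
    by_cases hG : top ρ σ N T = 0
    · exact ih T (N - 1) L (mem_fil_sub_one hρ.ne' hT hG) hC hpow (by push_cast at hg; omega)
    -- A bound $N$ that is not attained was lowered above, which also reduces the gap. Here $N$ is
    -- the true degree of $T$ and `pow_proportional` applies.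
    · have hN : 0 ≤ N := HasDeg.nonneg hρ hσ ⟨hT, hG⟩
      obtain ⟨c, -, hc⟩ := pow_proportional hP.2 hG hV.le hN hb
      obtain ⟨v, hv⟩ : ∃ v : ℕ, V.toNat = v + 1 := ⟨V.toNat - 1, by omega⟩
      have hVv : V = v + 1 := by omega
      obtain ⟨n, rfl⟩ := Int.eq_ofNat_of_zero_le hN
      rw [Int.toNat_natCast, hv] at hc
      have h1 := pow_mem_fil hρσ hT (v + 1)
      have h2 := pow_mem_fil hρσ hP.1 n
      have e : (n : ℤ) * V = ((v + 1 : ℕ) : ℤ) * n := by rw [hVv]; push_cast; ring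
      rw [e] at h2
      have hcomm : P * (T ^ (v + 1) - c • P ^ n) - (T ^ (v + 1) - c • P ^ n) * P =
          P * T ^ (v + 1) - T ^ (v + 1) * P := by
        rw [mul_sub, sub_mul, mul_smul_comm, smul_mul_assoc, ← pow_succ, ← pow_succ']
        abel
      have h3 := comm_pow hρσ hT hC.1 v
      rw [← hcomm] at h3
      have hv0 : (v : K) + 1 ≠ 0 := by exact_mod_cast Nat.succ_ne_zero v
      -- With $V=v+1$ the degree bound becomes $VN-1$ and the commutator has degree $(V-1)N+L$, so
      -- the gap falls by exactly one.
      refine ih (T ^ (v + 1) - c • P ^ n) (((v + 1 : ℕ) : ℤ) * n - 1) (v * n + L) ?_ ⟨h3.1, ?_⟩ ?_ ?_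
      · refine mem_fil_sub_one hρ.ne' (sub_mem h1.1 (Submodule.smul_mem _ _ h2.1)) ?_
        rw [map_sub, map_smul, h1.2, h2.2, hc, Polynomial.smul_eq_C_mul, sub_self]
      · rw [h3.2]
        exact smul_ne_zero hv0 (mul_ne_zero (pow_ne_zero _ hG) hC.2)
      · obtain ⟨p, q, d, hp, hpq, hd⟩ := hpow
        -- The new bracket is $V t_N^{V-1}u$, where $t_N$ is the leading form of $T$, $t_N^V=c f^N$
        -- and $u^p=d f^q$. Its $pV$-th power is therefore a multiple of a power of $f$.
        refine ⟨p * (v + 1), n * (p * v) + q * (v + 1),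
          ((v : K) + 1) ^ (p * (v + 1)) * c ^ (p * v) * d ^ (v + 1), by positivity, ?_, ?_⟩
        · push_cast
          rw [hVv] at hpq ⊢
          linear_combination ((v : ℤ) + 1) * hpq
        · rw [h3.2, Polynomial.smul_eq_C_mul]
          calc _ = C (((v : K) + 1) ^ (p * (v + 1))) * (top ρ σ n T ^ (v + 1)) ^ (p * v) *
                (top ρ σ L (P * T - T * P) ^ p) ^ (v + 1) := by
                simp only [map_pow]; ring
            _ = _ := by
                rw [hc, hd]; simp only [map_mul, map_pow]; ring
      · push_cast at hg ⊢
        rw [hVv] at hg ⊢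
        linarith

theorem exists_bracketData [CharZero K] {ρ σ V : ℤ} (hρ : 0 < ρ) (hσ : 0 ≤ σ) (hV : 0 < V)
    {P Q : Weyl K} (hPQ : CommConst P Q) (hP : HasDeg ρ σ P V) :
    ∃ (N M : ℤ) (G u : Polynomial K), BracketData ρ σ V N M (top ρ σ V P) G u := by
  obtain ⟨c, hc, hcomm⟩ := hPQ
  obtain ⟨N, hN⟩ := exists_hasDeg hρ.ne' σ (CommConst.ne_zero (CommConst.symm ⟨c, hc, hcomm⟩))
  have hC := hasDeg_algebraMap ρ σ hc
  rw [← hcomm] at hC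
  have hle := hC.le (comm_mem_fil (by omega) hP.1 hN.1)
  obtain ⟨g, hg⟩ := Int.eq_ofNat_of_zero_le hle
  refine exists_bracketData_aux hρ hσ hV hP g Q N 0 hN.1 hC ⟨1, 0, c, one_pos, by simp, ?_⟩
    (by simpa using hg)
  rw [hcomm, Algebra.algebraMap_eq_smul_one, map_smul, top_one]
  simp [Polynomial.smul_eq_C_mul]

end Dixmier

/-! ### Root multiplicities in the bracket identity. -/

namespace Dixmier

open Polynomial (C derivative rootMultiplicity)

open Classical in
theorem sum_rootMultiplicity {K : Type*} [Field K] [IsAlgClosed K] (f : Polynomial K) :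
    ∑ α ∈ f.roots.toFinset, rootMultiplicity α f = f.natDegree := by
  simp only [← Polynomial.count_roots]
  rw [Multiset.toFinset_sum_count_eq]
  exact (IsAlgClosed.splits f).natDegree_eq_card_roots.symm

namespace BracketData

variable {K : Type*} [Field K] {ρ σ V N M : ℤ} {f G u : Polynomial K}

theorem rootMultiplicity_u (h : BracketData ρ σ V N M f G u) (α : K) :
    V * (rootMultiplicity α u : ℤ) = M * rootMultiplicity α f := by
  classical
  obtain ⟨p, q, c, hp, hpq, hu⟩ := h.power
  have hc : c ≠ 0 := by rintro rfl; exact pow_ne_zero p h.u_ne (by simp [hu])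
  have h1 := congrArg (fun g => Multiset.count α g.roots) hu
  simp only [Polynomial.roots_C_mul _ hc, Polynomial.roots_pow, Multiset.count_nsmul,
    Polynomial.count_roots] at h1
  have h2 : (p : ℤ) * rootMultiplicity α u = q * rootMultiplicity α f := by exact_mod_cast h1
  have hp' : (p : ℤ) ≠ 0 := by exact_mod_cast hp.ne'
  apply mul_left_cancel₀ hp'
  linear_combination V * h2 - (rootMultiplicity α f : ℤ) * hpq

theorem natDegree_u (h : BracketData ρ σ V N M f G u) :
    V * (u.natDegree : ℤ) = M * f.natDegree := by
  obtain ⟨p, q, c, hp, hpq, hu⟩ := h.power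
  have hc : c ≠ 0 := by rintro rfl; exact pow_ne_zero p h.u_ne (by simp [hu])
  have h1 := congrArg Polynomial.natDegree hu
  rw [Polynomial.natDegree_C_mul hc, Polynomial.natDegree_pow, Polynomial.natDegree_pow] at h1
  have h2 : (p : ℤ) * u.natDegree = q * f.natDegree := by exact_mod_cast h1
  have hp' : (p : ℤ) ≠ 0 := by exact_mod_cast hp.ne'
  apply mul_left_cancel₀ hp'
  linear_combination V * h2 - (f.natDegree : ℤ) * hpq

variable [CharZero K]

/-- The coefficient of $t^{\deg f+\deg G}$ in $t\rho u$ is $N\deg f-V\deg G$ times the leading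
coefficients. If it is nonzero, then $\deg u=\deg f+\deg G-1$ and `natDegree_u` gives the first
alternative; if it vanishes, $\deg u$ is smaller. -/
theorem degree_cases (h : BracketData ρ σ V N M f G u) (hρ : ρ ≠ 0) :
    V * (G.natDegree : ℤ) = f.natDegree * (N - (ρ + σ)) + V ∨
      (V * (G.natDegree : ℤ) = N * f.natDegree ∧
        u.natDegree + 1 < f.natDegree + G.natDegree) := by
  have hρK : (ρ : K) ≠ 0 := by exact_mod_cast hρ
  have e1 : (ρ : K) • (Polynomial.X * u) = (N : K) • (G * (Polynomial.X * derivative f)) -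
      (V : K) • (f * (Polynomial.X * derivative G)) := by
    have := h.bracket
    simp only [Polynomial.smul_eq_C_mul] at this ⊢
    linear_combination Polynomial.X * this
  have hdeg : (Polynomial.X * u).natDegree = u.natDegree + 1 :=
    Polynomial.natDegree_X_mul h.u_ne
  have hle : (Polynomial.X * u).natDegree ≤ G.natDegree + f.natDegree := by
    rw [← Polynomial.natDegree_smul_of_smul_regular _ (IsSMulRegular.of_ne_zero hρK), e1]
    refine (Polynomial.natDegree_sub_le_of_le (m := G.natDegree + f.natDegree)
      (n := G.natDegree + f.natDegree) ?_ ?_).trans (max_self _).le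
    · exact (Polynomial.natDegree_smul_le _ _).trans (Polynomial.natDegree_mul_le.trans
        (Nat.add_le_add_left (natDegree_X_mul_derivative_le f) _))
    · exact (Polynomial.natDegree_smul_le _ _).trans (Polynomial.natDegree_mul_le.trans
        (by have := natDegree_X_mul_derivative_le G; omega))
  have hco := congrArg (fun g => g.coeff (G.natDegree + f.natDegree)) e1
  simp only [Polynomial.coeff_smul, Polynomial.coeff_sub, smul_eq_mul] at hco
  rw [coeff_mul_X_mul_derivative, add_comm, coeff_mul_X_mul_derivative] at hco
  have hco' : (ρ : K) * (Polynomial.X * u).coeff (f.natDegree + G.natDegree) =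
      ((N * f.natDegree - V * G.natDegree : ℤ) : K) * (G.leadingCoeff * f.leadingCoeff) := by
    rw [hco]; push_cast; ring
  by_cases hz : V * (G.natDegree : ℤ) = N * f.natDegree
  · right
    refine ⟨hz, ?_⟩
    rw [hz, sub_self, Int.cast_zero, zero_mul] at hco'
    have h0 := (mul_eq_zero.1 hco').resolve_left hρK
    rw [← hdeg]
    refine lt_of_le_of_ne (by omega) fun heq => ?_
    rw [← heq, Polynomial.coeff_natDegree, Polynomial.leadingCoeff_eq_zero] at h0
    exact mul_ne_zero Polynomial.X_ne_zero h.u_ne h0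
  · left
    have hne : (Polynomial.X * u).coeff (f.natDegree + G.natDegree) ≠ 0 := by
      intro h0
      rw [h0, mul_zero, eq_comm, mul_eq_zero] at hco'
      rcases hco' with h1 | h1
      · rw [Int.cast_eq_zero] at h1; exact hz (by linarith)
      · exact mul_ne_zero (Polynomial.leadingCoeff_ne_zero.2 h.G_ne)
          (Polynomial.leadingCoeff_ne_zero.2 h.f_ne) h1
    have hge := Polynomial.le_natDegree_of_ne_zero hne
    have heq : (u.natDegree : ℤ) = f.natDegree + G.natDegree - 1 := by omega
    have h1 := h.natDegree_u
    rw [heq, h.M_eq] at h1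
    linear_combination h1

/-- The local analogue of `degree_cases`, at a root of multiplicity $e$ in $f$ and $s$ in $G$. Here
the lowest terms cannot cancel, so $u$ has multiplicity exactly $e+s-1$, and `rootMultiplicity_u`
determines $s$. -/
theorem rootMultiplicity_G (h : BracketData ρ σ V N M f G u) (hρ : ρ ≠ 0) (hρσ : 0 < ρ + σ)
    (hV : 0 < V) {α : K} (hα : f.IsRoot α) :
    V * (rootMultiplicity α G : ℤ) = rootMultiplicity α f * (N - (ρ + σ)) + V ∧
      rootMultiplicity α f * (ρ + σ) ≠ V := by
  have hρK : (ρ : K) ≠ 0 := by exact_mod_cast hρ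
  have he : 0 < rootMultiplicity α f := (Polynomial.rootMultiplicity_pos h.f_ne).2 hα
  obtain ⟨f1, hf1, hfd⟩ := Polynomial.exists_eq_pow_rootMultiplicity_mul_and_not_dvd f h.f_ne α
  obtain ⟨G1, hG1, hGd⟩ := Polynomial.exists_eq_pow_rootMultiplicity_mul_and_not_dvd G h.G_ne α
  rw [Polynomial.dvd_iff_isRoot] at hfd hGd
  have hk := h.rootMultiplicity_u α
  set e := rootMultiplicity α f
  set s := rootMultiplicity α G
  set k := rootMultiplicity α u
  set l : Polynomial K := Polynomial.X - C α with hl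
  have hdl : derivative l = 1 := by simp [hl]
  have hl0 : l ≠ 0 := Polynomial.X_sub_C_ne_zero α
  have hdf : l * derivative f = l ^ e * ((e : Polynomial K) * f1 + l * derivative f1) := by
    have := derivative_pow_mul_self l e
    rw [hdl] at this
    rw [hf1, Polynomial.derivative_mul]
    linear_combination f1 * this
  have hdG : l * derivative G = l ^ s * ((s : Polynomial K) * G1 + l * derivative G1) := by
    have := derivative_pow_mul_self l s
    rw [hdl] at this
    rw [hG1, Polynomial.derivative_mul]
    linear_combination G1 * this
  set B := C (N : K) * (G1 * ((e : Polynomial K) * f1 + l * derivative f1)) -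
    C (V : K) * (f1 * ((s : Polynomial K) * G1 + l * derivative G1)) with hB
  have hmain : C (ρ : K) * (l * u) = l ^ (e + s) * B := by
    have hb := h.bracket
    simp only [Polynomial.smul_eq_C_mul] at hb
    calc C (ρ : K) * (l * u) = C (N : K) * (G * (l * derivative f)) -
          C (V : K) * (f * (l * derivative G)) := by linear_combination l * hb
      _ = _ := by
          rw [hdf, hdG]; nth_rewrite 1 [hG1]; nth_rewrite 1 [hf1]; rw [hB]; ring
  have hBe : B.eval α = ((N * e - V * s : ℤ) : K) * (G1.eval α * f1.eval α) := by
    simp [hB, hl]; ring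
  have hu0 : l * u ≠ 0 := mul_ne_zero hl0 h.u_ne
  have hB0 : B ≠ 0 := by
    rintro hB0
    rw [hB0, mul_zero] at hmain
    exact mul_ne_zero (Polynomial.C_ne_zero.2 hρK) hu0 hmain
  have hmult : k + 1 = e + s + rootMultiplicity α B := by
    have h1 : rootMultiplicity α (C (ρ : K) * (l * u)) = 1 + k := by
      rw [Polynomial.rootMultiplicity_mul (mul_ne_zero (Polynomial.C_ne_zero.2 hρK) hu0),
        Polynomial.rootMultiplicity_C, Polynomial.rootMultiplicity_mul hu0,
        Polynomial.rootMultiplicity_X_sub_C_self, zero_add]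
    have h2 : rootMultiplicity α (l ^ (e + s) * B) = e + s + rootMultiplicity α B := by
      rw [Polynomial.rootMultiplicity_mul (mul_ne_zero (pow_ne_zero _ hl0) hB0),
        Polynomial.rootMultiplicity_X_sub_C_pow]
    rw [← h2, ← hmain, h1, add_comm]
  -- Cancellation would give $u$ multiplicity at least $e+s$, hence $Me\ge Ve+Vs=(V+N)e$, contrary
  -- to $M=V+N-(\rho+\sigma)<V+N$.
  have hne : N * e ≠ V * s := by
    intro hz
    have hr : B.IsRoot α := by rw [Polynomial.IsRoot, hBe, hz, sub_self]; simp
    have := (Polynomial.rootMultiplicity_pos hB0).2 hr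
    have hge : (e + s : ℤ) ≤ k := by exact_mod_cast (by omega : e + s ≤ k)
    have h3 := mul_le_mul_of_nonneg_left hge hV.le
    rw [hk, h.M_eq] at h3
    have : (0 : ℤ) < (ρ + σ) * e := mul_pos hρσ (by exact_mod_cast he)
    nlinarith
  have hr : ¬ B.IsRoot α := by
    rw [Polynomial.IsRoot, hBe]
    refine mul_ne_zero ?_ (mul_ne_zero hGd hfd)
    exact Int.cast_ne_zero.2 (sub_ne_zero.2 hne)
  rw [Polynomial.rootMultiplicity_eq_zero hr] at hmult
  have hkk : (k : ℤ) = e + s - 1 := by omega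
  rw [hkk, h.M_eq] at hk
  have h1 : V * (s : ℤ) = e * (N - (ρ + σ)) + V := by linear_combination hk
  exact ⟨h1, fun h2 => hne (by linear_combination h2 - h1)⟩

variable [IsAlgClosed K]

-- Sum the formula for the multiplicities of $G$ over the distinct roots of $f$; the sum of these
-- multiplicities is at most $\deg G$.
open Classical in
theorem card_roots_le (h : BracketData ρ σ V N M f G u) (hρ : ρ ≠ 0) (hρσ : 0 < ρ + σ)
    (hV : 0 < V) : f.natDegree * (N - (ρ + σ)) + f.roots.toFinset.card * V ≤
      V * (G.natDegree : ℤ) := by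
  have h1 : ∑ α ∈ f.roots.toFinset, rootMultiplicity α G ≤ G.natDegree := by
    refine le_trans ?_ (Polynomial.card_roots' G)
    simp only [← Polynomial.count_roots]
    rw [← Multiset.sum_count_eq_card (s := f.roots.toFinset ∪ G.roots.toFinset)
      (fun a ha => Finset.mem_union_right _ (Multiset.mem_toFinset.2 ha))]
    exact Finset.sum_le_sum_of_subset Finset.subset_union_left
  have h2 : V * ((∑ α ∈ f.roots.toFinset, rootMultiplicity α G : ℕ) : ℤ) =
      f.natDegree * (N - (ρ + σ)) + f.roots.toFinset.card * V := by
    rw [← sum_rootMultiplicity f]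
    push_cast
    rw [Finset.mul_sum, Finset.sum_mul, ← nsmul_eq_mul, ← Finset.sum_const,
      ← Finset.sum_add_distrib]
    refine Finset.sum_congr rfl fun α hα => ?_
    exact (h.rootMultiplicity_G hρ hρσ hV
      (Polynomial.isRoot_of_mem_roots (Multiset.mem_toFinset.1 hα))).1
  rw [← h2]
  exact mul_le_mul_of_nonneg_left (by exact_mod_cast h1) hV.le

open Classical in
/-- Either `f` has at most one root, or the degrees of `f` and `G` are proportional to `V` and `N`
and the number of roots of `f` is bounded. -/
theorem roots_cases (h : BracketData ρ σ V N M f G u) (hρ : ρ ≠ 0) (hρσ : 0 < ρ + σ)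
    (hV : 0 < V) : f.roots.toFinset.card ≤ 1 ∨
      (V * (G.natDegree : ℤ) = N * f.natDegree ∧ u.natDegree + 1 < f.natDegree + G.natDegree ∧
        f.roots.toFinset.card * V ≤ (ρ + σ) * f.natDegree) := by
  have h1 := h.card_roots_le hρ hρσ hV
  rcases h.degree_cases hρ with h2 | ⟨h2, h3⟩
  · left
    have : (f.roots.toFinset.card : ℤ) * V ≤ 1 * V := by linarith
    exact_mod_cast le_of_mul_le_mul_right this hV
  · right
    exact ⟨h2, h3, by linarith⟩

end BracketData

end Dixmier

/-! ### Elementary automorphisms and their effect on leading forms. -/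

namespace Dixmier

open Polynomial (C derivative rootMultiplicity)

variable {K : Type*} [Field K]

/-- The endomorphism of the Weyl algebra with `X ↦ A` and `Y ↦ B`. -/
noncomputable def lift (A B : Weyl K) (h : B * A = A * B + 1) : Weyl K →ₐ[K] Weyl K :=
  RingQuot.liftAlgHom K ⟨FreeAlgebra.lift K ![A, B], by rintro _ _ ⟨⟩; simpa using h⟩

theorem lift_X (A B : Weyl K) (h : B * A = A * B + 1) : lift A B h (X K) = A := by
  simp [lift, X, RingQuot.liftAlgHom_mkAlgHom_apply]

theorem lift_Y (A B : Weyl K) (h : B * A = A * B + 1) : lift A B h (Y K) = B := by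
  simp [lift, Y, RingQuot.liftAlgHom_mkAlgHom_apply]

theorem weylHom_ext {S : Type*} [Ring S] [Algebra K S] {φ ψ : Weyl K →ₐ[K] S}
    (hX : φ (X K) = ψ (X K)) (hY : φ (Y K) = ψ (Y K)) : φ = ψ := by
  have h : φ.toLinearMap = ψ.toLinearMap := by
    apply (monoBasis K).ext
    rintro ⟨i, j⟩
    simp [monoBasis_apply, hX, hY]
  exact AlgHom.ext fun P => DFunLike.congr_fun h P

/-- An automorphism of the Weyl algebra given by the images of the generators under it and its
inverse. -/
noncomputable def weylEquiv (A B A' B' : Weyl K) (h : B * A = A * B + 1)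
    (h' : B' * A' = A' * B' + 1) (h1 : lift A' B' h' A = X K) (h2 : lift A' B' h' B = Y K)
    (h3 : lift A B h A' = X K) (h4 : lift A B h B' = Y K) : Weyl K ≃ₐ[K] Weyl K :=
  AlgEquiv.ofAlgHom (lift A B h) (lift A' B' h')
    (weylHom_ext (by simp [lift_X, h3]) (by simp [lift_Y, h4]))
    (weylHom_ext (by simp [lift_X, h1]) (by simp [lift_Y, h2]))

theorem shearX_rel (μ : K) (m : ℕ) :
    Y K * (X K + μ • Y K ^ m) = (X K + μ • Y K ^ m) * Y K + 1 := by
  rw [mul_add, add_mul, Y_mul_X, mul_smul_comm, smul_mul_assoc, ← pow_succ, ← pow_succ']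
  abel

theorem shearY_rel (α : K) (k : ℕ) :
    (Y K + α • X K ^ k) * X K = X K * (Y K + α • X K ^ k) + 1 := by
  rw [mul_add, add_mul, Y_mul_X, mul_smul_comm, smul_mul_assoc, ← pow_succ, ← pow_succ']
  abel

theorem swap_rel : ((-1 : K) • X K) * Y K = Y K * ((-1 : K) • X K) + 1 := by
  rw [mul_smul_comm, smul_mul_assoc, Y_mul_X]; module

theorem swap_rel' : X K * ((-1 : K) • Y K) = ((-1 : K) • Y K) * X K + 1 := by
  rw [mul_smul_comm, smul_mul_assoc, Y_mul_X]; module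

/-- The automorphism `X ↦ X + μ Y ^ m`, `Y ↦ Y`. -/
noncomputable def shearX (μ : K) (m : ℕ) : Weyl K ≃ₐ[K] Weyl K :=
  weylEquiv (X K + μ • Y K ^ m) (Y K) (X K + (-μ) • Y K ^ m) (Y K) (shearX_rel μ m)
    (shearX_rel (-μ) m) (by simp only [map_add, map_smul, map_pow, lift_X, lift_Y]; module) (by simp [lift_Y])
    (by simp only [map_add, map_smul, map_pow, lift_X, lift_Y]; module) (by simp [lift_Y])

/-- The automorphism `X ↦ X`, `Y ↦ Y + α X ^ k`. -/
noncomputable def shearY (α : K) (k : ℕ) : Weyl K ≃ₐ[K] Weyl K :=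
  weylEquiv (X K) (Y K + α • X K ^ k) (X K) (Y K + (-α) • X K ^ k) (shearY_rel α k)
    (shearY_rel (-α) k) (by simp [lift_X]) (by simp only [map_add, map_smul, map_pow, lift_X, lift_Y]; module)
    (by simp [lift_X]) (by simp only [map_add, map_smul, map_pow, lift_X, lift_Y]; module)

/-- The automorphism `X ↦ Y`, `Y ↦ -X`. -/
noncomputable def swap (K : Type*) [Field K] : Weyl K ≃ₐ[K] Weyl K :=
  weylEquiv (Y K) ((-1 : K) • X K) ((-1 : K) • Y K) (X K) swap_rel swap_rel' (by simp [lift_Y])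
    (by simp [lift_X, smul_smul]) (by simp [lift_Y, smul_smul]) (by simp [lift_X])

theorem shearX_X (μ : K) (m : ℕ) : shearX μ m (X K) = X K + μ • Y K ^ m := lift_X _ _ _
theorem shearX_Y (μ : K) (m : ℕ) : shearX μ m (Y K) = Y K := lift_Y _ _ _
theorem shearX_symm_X (μ : K) (m : ℕ) : (shearX μ m).symm (X K) = X K + (-μ) • Y K ^ m :=
  lift_X _ _ _
theorem shearX_symm_Y (μ : K) (m : ℕ) : (shearX μ m).symm (Y K) = Y K := lift_Y _ _ _
theorem shearY_X (α : K) (k : ℕ) : shearY α k (X K) = X K := lift_X _ _ _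
theorem shearY_Y (α : K) (k : ℕ) : shearY α k (Y K) = Y K + α • X K ^ k := lift_Y _ _ _
theorem shearY_symm_X (α : K) (k : ℕ) : (shearY α k).symm (X K) = X K := lift_X _ _ _
theorem shearY_symm_Y (α : K) (k : ℕ) : (shearY α k).symm (Y K) = Y K + (-α) • X K ^ k :=
  lift_Y _ _ _
theorem swap_X : swap K (X K) = Y K := lift_X _ _ _
theorem swap_Y : swap K (Y K) = (-1 : K) • X K := lift_Y _ _ _
theorem swap_symm_X : (swap K).symm (X K) = (-1 : K) • Y K := lift_X _ _ _
theorem swap_symm_Y : (swap K).symm (Y K) = X K := lift_Y _ _ _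

theorem X_mem_fil {ρ σ m : ℤ} (h : ρ ≤ m) : X K ∈ fil ρ σ m := by
  simpa using mono_mem_fil (K := K) (ρ := ρ) (σ := σ) (m := m) (i := 1) (j := 0) (by simpa)

theorem Y_pow_mem_fil {ρ σ m : ℤ} (j : ℕ) (h : σ * j ≤ m) : Y K ^ j ∈ fil ρ σ m := by
  simpa using mono_mem_fil (K := K) (ρ := ρ) (σ := σ) (m := m) (i := 0) (j := j) (by simpa)

theorem X_pow_mem_fil {ρ σ m : ℤ} (i : ℕ) (h : ρ * i ≤ m) : X K ^ i ∈ fil ρ σ m := by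
  simpa using mono_mem_fil (K := K) (ρ := ρ) (σ := σ) (m := m) (i := i) (j := 0) (by simpa)

theorem Y_mem_fil {ρ σ m : ℤ} (h : σ ≤ m) : Y K ∈ fil ρ σ m := by
  simpa using Y_pow_mem_fil (K := K) (ρ := ρ) 1 (by simpa)

section Map

variable {ρ σ ρ' σ' : ℤ} (hρσ : 0 < ρ' + σ') {φ : Weyl K →ₐ[K] Weyl K}
  (hX : φ (X K) ∈ fil ρ' σ' ρ) (hY : φ (Y K) ∈ fil ρ' σ' σ)

include hρσ hX hY

theorem map_mono_mem_fil (i j : ℕ) : φ (X K ^ i * Y K ^ j) ∈ fil ρ' σ' (ρ * i + σ * j) ∧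
    top ρ' σ' (ρ * i + σ * j) (φ (X K ^ i * Y K ^ j)) =
      top ρ' σ' ρ (φ (X K)) ^ i * top ρ' σ' σ (φ (Y K)) ^ j := by
  have h1 := pow_mem_fil hρσ hX i
  have h2 := pow_mem_fil hρσ hY j
  rw [map_mul, map_pow, map_pow, mul_comm ρ, mul_comm σ, top_mul hρσ h1.1 h2.1, h1.2, h2.2]
  exact ⟨mul_mem_fil hρσ h1.1 h2.1, rfl⟩

theorem map_mem_fil {m : ℤ} {P : Weyl K} (hP : P ∈ fil ρ σ m) : φ P ∈ fil ρ' σ' m := by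
  refine fil_induction hP (p := fun P => φ P ∈ fil ρ' σ' m) ?_ (by simp) ?_ ?_
  · exact fun i j hij => fil_mono hij (map_mono_mem_fil hρσ hX hY i j).1
  · intro A B hA hB; rw [map_add]; exact add_mem hA hB
  · intro c A hA; rw [map_smul]; exact Submodule.smul_mem _ _ hA

/-- The linear maps `L₁` and `L₂` let coefficient extraction, evaluation and substitution all be
checked on monomials alone. -/
theorem top_map {M : Type*} [AddCommGroup M] [Module K M] (L₁ L₂ : Polynomial K →ₗ[K] M) {m : ℤ}
    (h : ∀ i j : ℕ, ρ * i + σ * j = m →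
      L₁ (top ρ' σ' ρ (φ (X K)) ^ i * top ρ' σ' σ (φ (Y K)) ^ j) = L₂ (Polynomial.X ^ j))
    {P : Weyl K} (hP : P ∈ fil ρ σ m) : L₁ (top ρ' σ' m (φ P)) = L₂ (top ρ σ m P) := by
  refine fil_induction hP (p := fun P => L₁ (top ρ' σ' m (φ P)) = L₂ (top ρ σ m P)) ?_ (by simp)
    ?_ ?_
  · intro i j hij
    have h1 := map_mono_mem_fil hρσ hX hY i j
    rw [top_mono]
    split_ifs with he
    · rw [← h i j he, ← h1.2, he]
    · rw [top_eq_zero_of_mem_fil (lt_of_le_of_ne hij he) h1.1]; simp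
  · intro A B hA hB; simp only [map_add, hA, hB]
  · intro c A hA; simp only [map_smul, hA]

end Map

/-- The degree cannot drop, since the inverse respects the same filtrations. -/
theorem hasDeg_map {ρ σ ρ' σ' : ℤ} (hρ : ρ ≠ 0) (hρ' : ρ' ≠ 0) (hρσ : 0 < ρ + σ)
    (hρσ' : 0 < ρ' + σ') (φ : Weyl K ≃ₐ[K] Weyl K)
    (hX : φ (X K) ∈ fil ρ' σ' ρ) (hY : φ (Y K) ∈ fil ρ' σ' σ)
    (hX' : φ.symm (X K) ∈ fil ρ σ ρ') (hY' : φ.symm (Y K) ∈ fil ρ σ σ') {P : Weyl K} {m : ℤ}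
    (h : HasDeg ρ σ P m) : HasDeg ρ' σ' (φ P) m := by
  rw [hasDeg_iff hρ] at h
  rw [hasDeg_iff hρ']
  refine ⟨map_mem_fil (φ := (φ : Weyl K →ₐ[K] Weyl K)) hρσ' hX hY h.1, fun h' => h.2 ?_⟩
  have := map_mem_fil (φ := (φ.symm : Weyl K →ₐ[K] Weyl K)) hρσ hX' hY' h'
  simpa using this

theorem shearX_hasDeg {m : ℕ} {σ : ℤ} (hm : 0 < m) (hσ : 0 < σ) (μ : K) {P : Weyl K} {V : ℤ}
    (h : HasDeg (σ * m) σ P V) : HasDeg (σ * m) σ (shearX μ m P) V := by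
  have hp : 0 < σ * m := by positivity
  have h1 : ∀ ν : K, X K + ν • Y K ^ m ∈ fil (σ * m) σ (σ * m) := fun ν =>
    add_mem (X_mem_fil le_rfl) (Submodule.smul_mem _ _ (Y_pow_mem_fil _ le_rfl))
  refine hasDeg_map hp.ne' hp.ne' (by omega) (by omega) _ ?_ ?_ ?_ ?_ h
  · rw [shearX_X]; exact h1 _
  · rw [shearX_Y]; exact Y_mem_fil le_rfl
  · rw [shearX_symm_X]; exact h1 _
  · rw [shearX_symm_Y]; exact Y_mem_fil le_rfl

theorem shearY_hasDeg {k : ℕ} (α : K) {P : Weyl K} {V : ℤ}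
    (h : HasDeg 1 k P V) : HasDeg 1 k (shearY α k P) V := by
  have h1 : ∀ ν : K, Y K + ν • X K ^ k ∈ fil 1 k k := fun ν =>
    add_mem (Y_mem_fil le_rfl) (Submodule.smul_mem _ _ (X_pow_mem_fil _ (by simp)))
  refine hasDeg_map one_ne_zero one_ne_zero (by omega) (by omega) _ ?_ ?_ ?_ ?_ h
  · rw [shearY_X]; exact X_mem_fil le_rfl
  · rw [shearY_Y]; exact h1 _
  · rw [shearY_symm_X]; exact X_mem_fil le_rfl
  · rw [shearY_symm_Y]; exact h1 _

theorem swap_hasDeg {P : Weyl K} {V : ℤ} (h : HasDeg 1 1 P V) : HasDeg 1 1 (swap K P) V := by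
  refine hasDeg_map one_ne_zero one_ne_zero (by omega) (by omega) _ ?_ ?_ ?_ ?_ h
  · rw [swap_X]; exact Y_mem_fil le_rfl
  · rw [swap_Y]; exact Submodule.smul_mem _ _ (X_mem_fil le_rfl)
  · rw [swap_symm_X]; exact Submodule.smul_mem _ _ (Y_mem_fil le_rfl)
  · rw [swap_symm_Y]; exact X_mem_fil le_rfl

theorem swap_mem_fil {ρ σ m : ℤ} (hρσ : 0 < ρ + σ) {P : Weyl K} (h : P ∈ fil ρ σ m) :
    swap K P ∈ fil σ ρ m := by
  refine map_mem_fil (φ := (swap K : Weyl K →ₐ[K] Weyl K)) (by omega) ?_ ?_ h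
  · rw [AlgEquiv.coe_toAlgHom, swap_X]; exact Y_mem_fil le_rfl
  · rw [AlgEquiv.coe_toAlgHom, swap_Y]; exact Submodule.smul_mem _ _ (X_mem_fil le_rfl)

theorem mem_fil_of_swap {ρ σ m : ℤ} (hρσ : 0 < ρ + σ) {P : Weyl K} (h : swap K P ∈ fil σ ρ m) :
    P ∈ fil ρ σ m := by
  have := map_mem_fil (φ := ((swap K).symm : Weyl K →ₐ[K] Weyl K)) (ρ' := ρ) (σ' := σ)
    (by omega) ?_ ?_ h
  · simpa using this
  · rw [AlgEquiv.coe_toAlgHom, swap_symm_X]; exact Submodule.smul_mem _ _ (Y_mem_fil le_rfl)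
  · rw [AlgEquiv.coe_toAlgHom, swap_symm_Y]; exact X_mem_fil le_rfl

theorem top_X {ρ : ℤ} (σ : ℤ) : top ρ σ ρ (X K) = 1 := by
  simpa using top_mono (K := K) ρ σ ρ 1 0

theorem top_Y_pow (ρ σ : ℤ) (j : ℕ) {m : ℤ} (h : σ * j = m) :
    top ρ σ m (Y K ^ j) = Polynomial.X ^ j := by
  simpa [h] using top_mono (K := K) ρ σ m 0 j

theorem top_Y {ρ : ℤ} (σ : ℤ) : top ρ σ σ (Y K) = Polynomial.X := by
  simpa using top_Y_pow (K := K) ρ σ 1 (m := σ) (by simp)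

theorem top_shearY {k : ℕ} (α : K) {P : Weyl K} {V : ℤ} (h : P ∈ fil 1 k V) :
    top 1 k V (shearY α k P) = (top 1 k V P).comp (Polynomial.X + C α) := by
  have h1 : top 1 k k (X K ^ k) = 1 := by
    simpa using top_mono (K := K) 1 k k k 0
  refine top_map (φ := (shearY α k : Weyl K →ₐ[K] Weyl K)) (ρ' := 1) (σ' := k) (by omega) ?_ ?_
    LinearMap.id (Polynomial.aeval (Polynomial.X + C α)).toLinearMap ?_ h
  · rw [AlgEquiv.coe_toAlgHom, shearY_X]; exact X_mem_fil le_rfl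
  · rw [AlgEquiv.coe_toAlgHom, shearY_Y]
    exact add_mem (Y_mem_fil le_rfl) (Submodule.smul_mem _ _ (X_pow_mem_fil _ (by simp)))
  · intro i j _
    rw [AlgEquiv.coe_toAlgHom, shearY_X, shearY_Y, top_X, map_add, map_smul, top_Y, h1]
    simp [Polynomial.smul_eq_C_mul]

theorem top_shearX_X (μ : K) {m : ℕ} : top m 1 m (shearX μ m (X K)) =
    1 + C μ * Polynomial.X ^ m := by
  rw [shearX_X, map_add, map_smul, top_X, top_Y_pow _ _ _ (by simp), Polynomial.smul_eq_C_mul]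

theorem top_shearX {M : Type*} [AddCommGroup M] [Module K M] (L₁ L₂ : Polynomial K →ₗ[K] M)
    (μ : K) {m V : ℕ} (h : ∀ i j : ℕ, m * i + j = V →
      L₁ ((1 + C μ * Polynomial.X ^ m) ^ i * Polynomial.X ^ j) = L₂ (Polynomial.X ^ j))
    {P : Weyl K} (hP : P ∈ fil m 1 V) :
    L₁ (top m 1 V (shearX μ m P)) = L₂ (top m 1 V P) := by
  refine top_map (φ := (shearX μ m : Weyl K →ₐ[K] Weyl K)) (ρ' := m) (σ' := 1) (by omega) ?_ ?_
    L₁ L₂ ?_ hP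
  · rw [AlgEquiv.coe_toAlgHom, shearX_X]
    exact add_mem (X_mem_fil le_rfl) (Submodule.smul_mem _ _ (Y_pow_mem_fil _ (by simp)))
  · rw [AlgEquiv.coe_toAlgHom, shearX_Y]; exact Y_mem_fil le_rfl
  · intro i j hij
    rw [AlgEquiv.coe_toAlgHom, top_shearX_X, shearX_Y, top_Y]
    exact h i j (by rw [one_mul] at hij; exact_mod_cast hij)

/-- For a form $h$ of $(m,1)$-degree $V$, the coefficient of $y^V$ after $x\mapsto x+\mu y^m$ is
$h(\mu,1)$. Homogeneity gives $\nu^Vh(\mu,1)=h(\mu\nu^m,\nu)=h(1,\nu)$. -/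
theorem coeff_top_shearX {μ ν : K} {m V : ℕ} (hm : 0 < m) (hν : ν ^ m * μ = 1) {P : Weyl K}
    (hP : P ∈ fil m 1 V) :
    ν ^ V * (top m 1 V (shearX μ m P)).coeff V = (top m 1 V P).eval ν := by
  refine top_shearX (ν ^ V • Polynomial.lcoeff K V) (Polynomial.leval ν) μ ?_ hP
  intro i j hij
  have h2 : ((1 + C μ * Polynomial.X ^ m) ^ i).coeff (m * i) = μ ^ i := by
    have hd : (1 + C μ * Polynomial.X ^ m : Polynomial K).natDegree ≤ m := by
      compute_degree
    rw [mul_comm m i, Polynomial.coeff_pow_of_natDegree_le hd]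
    simp [Polynomial.coeff_one, hm.ne']
  rw [← hij]
  simp only [LinearMap.smul_apply, Polynomial.lcoeff_apply, Polynomial.coeff_mul_X_pow, h2,
    Polynomial.leval_apply, Polynomial.eval_pow, Polynomial.eval_X, smul_eq_mul]
  rw [pow_add, pow_mul]
  calc _ = (ν ^ m * μ) ^ i * ν ^ j := by ring
    _ = _ := by rw [hν]; simp

/-- In the coordinate $t=y/x$ this linear shear is a Möbius transformation, and the prefactor comes
from homogeneity. -/
theorem eval_top_shearX {μ τ : K} {V : ℕ} (hτ : 1 + μ * τ ≠ 0) {P : Weyl K}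
    (hP : P ∈ fil 1 1 V) : (top 1 1 V (shearX μ 1 P)).eval τ =
      (1 + μ * τ) ^ V * (top 1 1 V P).eval (τ / (1 + μ * τ)) := by
  refine top_shearX (m := 1) (Polynomial.leval τ)
    ((1 + μ * τ) ^ V • Polynomial.leval (τ / (1 + μ * τ))) μ ?_ hP
  intro i j hij
  rw [← hij]
  simp only [LinearMap.smul_apply, Polynomial.leval_apply, smul_eq_mul]
  simp
  rw [pow_add, div_pow]
  field_simp

theorem CommConst.map {P Q : Weyl K} (h : CommConst P Q) (φ : Weyl K ≃ₐ[K] Weyl K) :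
    CommConst (φ P) (φ Q) := by
  obtain ⟨c, hc, h⟩ := h
  exact ⟨c, hc, by rw [← map_mul, ← map_mul, ← map_sub, h, AlgEquiv.commutes]⟩

theorem IsCounterexample.map {P Q : Weyl K} (h : IsCounterexample P Q) (φ : Weyl K ≃ₐ[K] Weyl K) :
    IsCounterexample (φ P) (φ Q) := by
  obtain ⟨f, rfl, rfl, h⟩ := h
  refine ⟨(φ : Weyl K →ₐ[K] Weyl K).comp f, rfl, rfl, fun hb => h ?_⟩
  have : Function.Bijective (φ ∘ f) := hb
  exact (Function.Bijective.of_comp_iff' φ.bijective f).1 this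

theorem IsCounterexample.commConst {P Q : Weyl K} (h : IsCounterexample P Q) :
    CommConst P Q := by
  obtain ⟨f, rfl, rfl, h⟩ := h
  refine ⟨-1, by simp, ?_⟩
  rw [← map_mul, ← map_mul, Y_mul_X]
  simp

theorem deg_eq_of_hasDeg {ρ σ m : ℤ} (hρ : ρ ≠ 0) {P : Weyl K} (h : HasDeg ρ σ P m) :
    deg ρ σ P = (m : WithBot ℤ) := by
  apply le_antisymm
  · apply Finset.sup_le
    intro z hz
    obtain ⟨i, j, rfl, hij⟩ := mem_supp.1 hz
    exact WithBot.coe_le_coe.2 (mem_fil.1 h.1 i j hij)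
  · obtain ⟨i, j, hm, hij⟩ := exists_coeff_ne hρ h.2
    have := Finset.le_sup (f := fun p => (val ρ σ p : WithBot ℤ))
      (mem_supp.2 ⟨i, j, rfl, hij⟩)
    simp only [val, hm] at this
    exact this

theorem totalDeg_eq_of_hasDeg {P : Weyl K} {m : ℕ} (h : HasDeg 1 1 P m) : totalDeg P = m := by
  have h1 := deg_one_one P h.ne_zero
  rw [deg_eq_of_hasDeg one_ne_zero h] at h1
  exact_mod_cast (WithBot.coe_injective h1).symm

theorem exists_hasDeg_nat {P : Weyl K} (hP : P ≠ 0) : ∃ m : ℕ, HasDeg 1 1 P m := by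
  obtain ⟨m, hm⟩ := exists_hasDeg one_ne_zero 1 hP
  obtain ⟨n, rfl⟩ := Int.eq_ofNat_of_zero_le (hm.nonneg one_pos zero_le_one)
  exact ⟨n, hm⟩

end Dixmier

/-! ### Monomial leading forms and admissible edges. -/

namespace Dixmier

open Polynomial (C derivative rootMultiplicity)

section Factor

variable {K : Type*} [Field K] [IsAlgClosed K]

open Classical in
theorem eq_prod_roots (f : Polynomial K) : f = C f.leadingCoeff *
    ∏ α ∈ f.roots.toFinset, (Polynomial.X - C α) ^ rootMultiplicity α f := by
  conv_lhs => rw [(IsAlgClosed.splits f).eq_prod_roots]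
  rw [← Polynomial.prod_multiset_root_eq_finset_root]

open Classical in
theorem eq_pow_of_card_roots_le_one {f : Polynomial K} (hf : f ≠ 0)
    (h : f.roots.toFinset.card ≤ 1) : ∃ (c α : K) (b : ℕ), c ≠ 0 ∧
      f = C c * (Polynomial.X - C α) ^ b := by
  have h0 := Polynomial.leadingCoeff_ne_zero.2 hf
  have h1 := eq_prod_roots f
  rcases Nat.le_one_iff_eq_zero_or_eq_one.1 h with h2 | h2
  · rw [Finset.card_eq_zero.1 h2] at h1
    exact ⟨_, 0, 0, h0, by simpa using h1⟩
  · obtain ⟨α, hα⟩ := Finset.card_eq_one.1 h2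
    rw [hα, Finset.prod_singleton] at h1
    exact ⟨_, α, _, h0, h1⟩

open Classical in
theorem eq_pow_mul_pow_of_card_roots_le_two {f : Polynomial K} (hf : f ≠ 0)
    (h : f.roots.toFinset.card ≤ 2) : ∃ (c α β : K) (a b : ℕ), c ≠ 0 ∧ α ≠ β ∧
      f = C c * ((Polynomial.X - C α) ^ b * (Polynomial.X - C β) ^ a) := by
  rcases Nat.lt_or_eq_of_le h with h2 | h2
  · obtain ⟨c, α, b, hc, hf⟩ := eq_pow_of_card_roots_le_one hf (by omega)
    exact ⟨c, α, α + 1, 0, b, hc, by simp, by simpa using hf⟩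
  · obtain ⟨α, β, hαβ, he⟩ := Finset.card_eq_two.1 h2
    have h1 := eq_prod_roots f
    rw [he, Finset.prod_pair hαβ] at h1
    exact ⟨_, α, β, _, _, Polynomial.leadingCoeff_ne_zero.2 hf, hαβ, h1⟩

end Factor

variable {K : Type*} [Field K]

/-- The constant commutator lies below degree $V+W-(\rho+\sigma)$, so the leading forms
Poisson-commute. -/
theorem top_pow_proportional [CharZero K] {ρ σ V W : ℤ} (hρ : 0 < ρ) (hσ : 0 ≤ σ) {P Q : Weyl K}
    (hPQ : CommConst P Q) (hP : HasDeg ρ σ P V) (hQ : HasDeg ρ σ Q W) (h : ρ + σ < V + W) :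
    ∃ c : K, c ≠ 0 ∧ top ρ σ W Q ^ V.toNat = C c * top ρ σ V P ^ W.toNat := by
  obtain ⟨d, hd, hcomm⟩ := hPQ
  have hb := top_comm (by omega) hP.1 hQ.1
  rw [hcomm, top_eq_zero_of_mem_fil (m := 0) (by omega) (hasDeg_algebraMap ρ σ hd).1, smul_zero,
    eq_comm, sub_eq_zero] at hb
  exact pow_proportional hP.2 hQ.2 (hP.nonneg hρ hσ) (hQ.nonneg hρ hσ) hb

theorem natDegree_top_le {ρ σ V : ℤ} {n : ℕ} {P : Weyl K}
    (h : ∀ i j : ℕ, ρ * i + σ * j = V → j ≤ n) : (top ρ σ V P).natDegree ≤ n := by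
  rw [Polynomial.natDegree_le_iff_coeff_eq_zero]
  intro j hj
  by_contra hc
  obtain ⟨i, hi⟩ := exists_of_coeff_top_ne hc
  exact absurd (h i j hi) (by omega)

theorem exists_ne_zero_eval_ne [Infinite K] {f : Polynomial K} (hf : f ≠ 0) :
    ∃ ν : K, ν ≠ 0 ∧ f.eval ν ≠ 0 := by
  by_contra! hc
  refine mul_ne_zero Polynomial.X_ne_zero hf (Polynomial.funext fun ν => ?_)
  by_cases h : ν = 0
  · simp [h]
  · simp [hc ν h]

variable [CharZero K] [IsAlgClosed K]

/-- By a linear automorphism the leading form of highest total degree becomes a monomial. -/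
theorem exists_monomial_top {P Q : Weyl K} (hPQ : CommConst P Q) {V : ℕ} (hV : 0 < V)
    (hP : HasDeg 1 1 P V) : ∃ φ : Weyl K ≃ₐ[K] Weyl K,
      (∀ (R : Weyl K) (m : ℤ), HasDeg 1 1 R m → HasDeg 1 1 (φ R) m) ∧
      ∃ (c : K) (b : ℕ), c ≠ 0 ∧ top 1 1 V (φ P) = C c * Polynomial.X ^ b := by
  classical
  have hx (μ : K) (R : Weyl K) (m : ℤ) (h : HasDeg 1 1 R m) : HasDeg 1 1 (shearX μ 1 R) m := by
    simpa using shearX_hasDeg (m := 1) (σ := 1) one_pos one_pos μ (by simpa using h)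
  have hy (μ : K) (R : Weyl K) (m : ℤ) (h : HasDeg 1 1 R m) : HasDeg 1 1 (shearY μ 1 R) m := by
    simpa using shearY_hasDeg (k := 1) μ (by simpa using h)
  -- A generic shear makes $y^V$ occur in the leading form, so that its degree in $t$ is the full
  -- $V$ and infinity is not a root.
  obtain ⟨ν, hν, hev⟩ := exists_ne_zero_eval_ne hP.2
  set P1 := shearX ν⁻¹ 1 P with hP1
  have hd1 : HasDeg 1 1 P1 V := hx _ _ _ hP
  have hco : (top 1 1 V P1).coeff V ≠ 0 := by
    intro h0
    have := coeff_top_shearX (μ := ν⁻¹) (ν := ν) (m := 1) (V := V) one_pos (by simp [hν])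
      (by simpa using hP.1)
    simp only [Nat.cast_one] at this
    rw [← hP1, h0, mul_zero] at this
    exact hev this.symm
  have hnd : (top 1 1 V P1).natDegree = V := by
    apply le_antisymm
    · exact natDegree_top_le fun i j h => by omega
    · exact Polynomial.le_natDegree_of_ne_zero hco
  obtain ⟨N, M, G, u, hB⟩ := exists_bracketData one_pos zero_le_one (by exact_mod_cast hV)
    (hPQ.map (shearX ν⁻¹ 1)) hd1
  rw [← hP1] at hB
  have hcard : (top 1 1 V P1).roots.toFinset.card ≤ 2 := by
    -- With $\rho+\sigma=2$ and $\deg f=V$ the root bound reads $rV\le 2V$.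
    rcases hB.roots_cases one_ne_zero (by norm_num) (by exact_mod_cast hV) with h | ⟨-, -, h⟩
    · omega
    · rw [hnd] at h
      have := le_of_mul_le_mul_right h (by exact_mod_cast hV)
      omega
  obtain ⟨c, α, β, a, b, hc, hαβ, hf⟩ := eq_pow_mul_pow_of_card_roots_le_two hd1.2 hcard
  have hab : b + a = V := by
    rw [← hnd, hf, Polynomial.natDegree_C_mul hc, Polynomial.natDegree_mul
      (pow_ne_zero _ (Polynomial.X_sub_C_ne_zero _)) (pow_ne_zero _ (Polynomial.X_sub_C_ne_zero _)),
      Polynomial.natDegree_pow, Polynomial.natDegree_pow, Polynomial.natDegree_X_sub_C,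
      Polynomial.natDegree_X_sub_C, mul_one, mul_one]
  set P2 := shearY α 1 P1 with hP2
  have hd2 : HasDeg 1 1 P2 V := hy _ _ _ hd1
  set δ := β - α with hδ
  have hδ0 : δ ≠ 0 := sub_ne_zero.2 hαβ.symm
  have hf2 : top 1 1 V P2 = C c * (Polynomial.X ^ b * (Polynomial.X - C δ) ^ a) := by
    have := top_shearY (k := 1) α (P := P1) (V := V) (by simpa using hd1.1)
    simp only [Nat.cast_one] at this
    rw [hP2, this, hf]
    simp only [Polynomial.mul_comp, Polynomial.C_comp, Polynomial.pow_comp, Polynomial.sub_comp,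
      Polynomial.X_comp, hδ, map_sub]
    ring
  -- The translation moves $\alpha$ to $0$ and $\beta$ to $\delta$; the last shear sends $\delta$ to
  -- infinity, leaving a multiple of $t^b$.
  refine ⟨((shearX ν⁻¹ 1).trans (shearY α 1)).trans (shearX δ⁻¹ 1), ?_, c * (-δ) ^ a, b,
    mul_ne_zero hc (pow_ne_zero _ (neg_ne_zero.2 hδ0)), ?_⟩
  · exact fun R m h => hx _ _ _ (hy _ _ _ (hx _ _ _ h))
  · change top 1 1 V (shearX δ⁻¹ 1 P2) = _
    apply Polynomial.eq_of_infinite_eval_eq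
    refine Set.Infinite.mono (s := {τ : K | τ ≠ -δ}) ?_ (Set.finite_singleton (-δ)).infinite_compl
    intro τ hτ
    have hτ' : 1 + δ⁻¹ * τ ≠ 0 := by
      intro h0
      apply hτ
      field_simp at h0
      linear_combination h0
    have h1 : δ + τ ≠ 0 := by
      intro h0; exact hτ (by linear_combination h0)
    change Polynomial.eval _ _ = Polynomial.eval _ _
    rw [eval_top_shearX hτ' hd2.1, hf2]
    simp only [Polynomial.eval_mul, Polynomial.eval_C, Polynomial.eval_pow, Polynomial.eval_X,
      Polynomial.eval_sub]
    have h2 : τ / (1 + δ⁻¹ * τ) - δ = -δ / (1 + δ⁻¹ * τ) := by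
      field_simp
      ring
    rw [h2, ← hab, div_pow, div_pow, pow_add]
    field_simp

/-- With one root the edge form is $c(t-\alpha)^b$. Then $\alpha=0$ leaves no second point, and
$\alpha\ne0$ gives a point at height $b-1$, impossible for $0<\sigma<\rho$. Otherwise put
$\delta=b+\deg G-1-\deg u\ge1$. The degree formulas give $V(\delta+1)=(\rho+\sigma)b$, and lattice
points make $\sigma\delta$ a multiple of $\rho$. If $a>0$ then $V>\sigma b$ forces
$0<\sigma\delta<\rho$, a contradiction. If $a=0$ then $V=\sigma b$ yields $\rho=\sigma\delta$. -/
theorem edge_exponent {P Q : Weyl K} (hPQ : CommConst P Q) {ρ σ : ℤ} (hσ : 0 < σ) (hρ : σ < ρ)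
    {a b : ℕ} (hb : (top ρ σ (ρ * a + σ * b) P).natDegree = b)
    (hP : HasDeg ρ σ P (ρ * a + σ * b)) {j : ℕ} (hj : j < b)
    (hcj : (top ρ σ (ρ * a + σ * b) P).coeff j ≠ 0) : a = 0 ∧ σ ∣ ρ := by
  classical
  have hρ0 : 0 < ρ := hσ.trans hρ
  have hV : 0 < ρ * a + σ * b := by
    have : 0 < σ * (b : ℤ) := mul_pos hσ (by exact_mod_cast (by omega : 0 < b))
    positivity
  obtain ⟨N, M, G, u, hB⟩ := exists_bracketData hρ0 hσ.le hV hPQ hP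
  set V := ρ * (a : ℤ) + σ * b with hVdef
  have hlatf : ∀ j, (top ρ σ V P).coeff j ≠ 0 → ∃ i : ℕ, ρ * i + σ * j = V :=
    fun j h => exists_of_coeff_top_ne h
  rcases hB.roots_cases hρ0.ne' (by omega) hV with h1 | ⟨h1, h2, -⟩
  · exfalso
    obtain ⟨c, α, n, hc, hf⟩ := eq_pow_of_card_roots_le_one hP.2 h1
    have hn : n = b := by
      rw [← hb, hf, Polynomial.natDegree_C_mul hc, Polynomial.natDegree_pow,
        Polynomial.natDegree_X_sub_C, mul_one]
    subst hn
    by_cases hα : α = 0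
    · rw [hf, hα] at hcj
      simp [Polynomial.coeff_X_pow, hj.ne] at hcj
    · have hne : (top ρ σ V P).coeff (n - 1) ≠ 0 := by
        rw [hf, Polynomial.coeff_C_mul, sub_eq_add_neg, ← map_neg, Polynomial.coeff_X_add_C_pow]
        have : n.choose (n - 1) = n := by
          rw [Nat.choose_symm_of_eq_add (by omega : n = (n - 1) + 1), Nat.choose_one_right]
        rw [this]
        have hn0 : (n : K) ≠ 0 := by exact_mod_cast (by omega : n ≠ 0)
        exact mul_ne_zero hc (mul_ne_zero (pow_ne_zero _ (neg_ne_zero.2 hα)) hn0)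
      obtain ⟨i, hi⟩ := hlatf _ hne
      rw [Nat.cast_sub (by omega : 1 ≤ n), hVdef] at hi
      push_cast at hi
      have h3 : ρ * ((i : ℤ) - a) = σ := by linear_combination hi
      have h4 : (i : ℤ) - a ≤ 0 := by
        by_contra hc
        nlinarith
      nlinarith
  · obtain ⟨s, hs⟩ := hB.lattice_G G.natDegree
      (Polynomial.leadingCoeff_ne_zero.2 hB.G_ne)
    obtain ⟨i, hi⟩ := hB.lattice_u u.natDegree (Polynomial.leadingCoeff_ne_zero.2 hB.u_ne)
    have h3 := hB.natDegree_u
    rw [hb] at h1 h2 h3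
    rw [hB.M_eq] at h3 hi
    set D := G.natDegree
    set E := u.natDegree
    set δ : ℤ := b + D - 1 - E with hδ
    have hδ1 : 1 ≤ δ := by omega
    have hVδ : V * (δ + 1) = (ρ + σ) * b := by
      rw [hδ]; linear_combination h1 - h3
    have hσδ : σ * δ = ρ * (i - a - s + 1) := by
      rw [hδ]; rw [hVdef] at hi; linear_combination hs - hi
    have ha : a = 0 := by
      by_contra ha
      have ha' : (1 : ℤ) ≤ a := by exact_mod_cast Nat.one_le_iff_ne_zero.2 ha
      have hb' : (0 : ℤ) < b := by exact_mod_cast (by omega : 0 < b)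
      have hVb : σ * b < V := by rw [hVdef]; nlinarith
      have h5 : σ * b * (δ + 1) < (ρ + σ) * b := by
        rw [← hVδ]; exact mul_lt_mul_of_pos_right hVb (by omega)
      have h6 : σ * δ < ρ := by
        by_contra hc
        nlinarith
      rw [hσδ] at h6
      have h7 : (i - a - s + 1 : ℤ) ≤ 0 := by
        by_contra hc
        nlinarith
      have : σ * δ ≤ 0 := by rw [hσδ]; exact mul_nonpos_of_nonneg_of_nonpos hρ0.le h7
      nlinarith
    refine ⟨ha, δ, ?_⟩
    have hb' : (b : ℤ) ≠ 0 := by exact_mod_cast (by omega : b ≠ 0)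
    apply mul_right_cancel₀ hb'
    rw [hVdef, ha] at hVδ
    linear_combination -hVδ

end Dixmier

/-! ### The edge to the right of a vertex, and pairs that generate $A_1$. -/

namespace Dixmier

open Polynomial (C derivative rootMultiplicity)

variable {K : Type*} [Field K]

/-- Some support point lies to the right of the vertex $(a,b)$, so the Newton polygon has an edge
leaving it in that direction. Since $(a,b)$ is the only point of total degree $a+b$, the edge falls
more steeply than slope $-1$, whence $\sigma<\rho$. -/
theorem exists_edge {P : Weyl K} {a b : ℕ} {c : K} (hc : c ≠ 0) (hP : HasDeg 1 1 P (a + b))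
    (htop : top 1 1 (a + b) P = C c * Polynomial.X ^ b) (h : P ∉ fil 1 0 a) :
    ∃ ρ σ : ℤ, 0 < σ ∧ σ < ρ ∧ HasDeg ρ σ P (ρ * a + σ * b) ∧
      (top ρ σ (ρ * a + σ * b) P).natDegree = b ∧
      ∃ j < b, (top ρ σ (ρ * a + σ * b) P).coeff j ≠ 0 := by
  classical
  have hcorner : cf a b P ≠ 0 := by
    rw [← coeff_top (σ := 1) one_ne_zero (m := (a : ℤ) + b) (by ring) P, htop]
    simpa using hc
  have hlt : ∀ i j : ℕ, cf i j P ≠ 0 → j ≠ b → i + j < a + b := by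
    intro i j hij hj
    have h1 := mem_fil.1 hP.1 i j hij
    refine lt_of_le_of_ne (by omega) fun he => hij ?_
    rw [← coeff_top (σ := 1) one_ne_zero (m := (a : ℤ) + b) (by omega) P, htop]
    simp [Polynomial.coeff_X_pow, hj]
  have hS : ∃ i j : ℕ, cf i j P ≠ 0 ∧ a < i := by
    by_contra! hc
    exact h (mem_fil.2 fun i j hij => by have := hc i j hij; omega)
  have hle : ∀ i j : ℕ, cf i j P ≠ 0 → i + j ≤ a + b := by
    intro i j hij
    have h1 := mem_fil.1 hP.1 i j hij
    omega
  obtain ⟨i0, j0, hij0, hi0⟩ := hS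
  -- The outermost edge has the least descent per unit to the right; the minimising point $(i,j)$
  -- gives the normal vector $(b-j,\,i-a)$.
  obtain ⟨⟨i, j⟩, hp, hmin⟩ := Finset.exists_min_image
    (((monoBasis K).repr P).support.filter fun p : ℕ × ℕ => a < p.1)
    (fun p : ℕ × ℕ => ((b : ℚ) - p.2) / (p.1 - a))
    ⟨(i0, j0), by simpa [hi0, cf] using hij0⟩
  have hp' : cf i j P ≠ 0 ∧ a < i := by simpa [cf] using hp
  obtain ⟨hij, hi⟩ := hp'
  have hjb : j ≠ b := by have := hle i j hij; omega
  have hsum := hlt i j hij hjb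
  have hmem : P ∈ fil ((b : ℤ) - j) ((i : ℤ) - a) (((b : ℤ) - j) * a + ((i : ℤ) - a) * b) := by
    refine mem_fil.2 fun k l hkl => ?_
    by_cases hk : a < k
    · have h1 := hmin (k, l) (by simpa [hk, cf] using hkl)
      simp only at h1
      have hi' : (0 : ℚ) < (i : ℚ) - a := sub_pos.2 (by exact_mod_cast hi)
      have hk' : (0 : ℚ) < (k : ℚ) - a := sub_pos.2 (by exact_mod_cast hk)
      rw [div_le_div_iff₀ hi' hk'] at h1
      have h2 : ((b : ℤ) - j) * ((k : ℤ) - a) ≤ ((b : ℤ) - l) * ((i : ℤ) - a) := by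
        exact_mod_cast h1
      linarith
    · have h1 := hle k l hkl
      have h2 : (l : ℤ) - b ≤ a - k := by omega
      have h3 : (0 : ℤ) ≤ a - k := by omega
      have h4 : ((i : ℤ) - a) * (l - b) ≤ (i - a) * (a - k) :=
        mul_le_mul_of_nonneg_left h2 (by omega)
      have h5 : ((i : ℤ) - a) * (a - k) ≤ (b - j) * (a - k) :=
        mul_le_mul_of_nonneg_right (by omega) h3
      linarith
  have hρ : (b : ℤ) - j ≠ 0 := by omega
  have hcb := coeff_top (K := K) hρ (rfl : ((b : ℤ) - j) * (a : ℕ) + ((i : ℤ) - a) * (b : ℕ) = _) P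
  refine ⟨b - j, i - a, by omega, by omega, ⟨hmem, top_ne_zero hρ rfl hcorner⟩, ?_, j, by omega, ?_⟩
  · apply le_antisymm
    · rw [Polynomial.natDegree_le_iff_coeff_eq_zero]
      intro l hl
      by_contra hcl
      obtain ⟨k, hk⟩ := exists_of_coeff_top_ne hcl
      rw [coeff_top hρ hk] at hcl
      have h1 := hlt k l hcl (by omega)
      have h2 : ((b : ℤ) - j) * (a - k) = (i - a) * (l - b) := by linear_combination -hk
      have h3 : (l : ℤ) - b < a - k := by omega
      have h4 : (0 : ℤ) < (l : ℤ) - b := by omega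
      have h5 : ((i : ℤ) - a) * (l - b) < (b - j) * (a - k) :=
        mul_lt_mul'' (by omega) h3 (by omega) h4.le
      linarith
    · exact Polynomial.le_natDegree_of_ne_zero (by rwa [hcb])
  · rwa [coeff_top hρ (i := i) (by ring)]

theorem eq_zero_of_mem_fil_neg {ρ σ m : ℤ} (hρ : 0 < ρ) (hσ : 0 ≤ σ) (hm : m < 0) {P : Weyl K}
    (h : P ∈ fil ρ σ m) : P = 0 := by
  by_contra hP
  obtain ⟨i, j, hij⟩ := exists_cf_ne hP
  have := mem_fil.1 h i j hij
  have : 0 ≤ ρ * (i : ℤ) + σ * j := by positivity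
  omega

theorem algebraMap_mem_fil (ρ σ : ℤ) (c : K) : algebraMap K (Weyl K) c ∈ fil ρ σ 0 := by
  rw [Algebra.algebraMap_eq_smul_one]
  exact Submodule.smul_mem _ _ (one_mem_fil ρ σ)

theorem top_algebraMap (ρ σ : ℤ) (c : K) : top ρ σ 0 (algebraMap K (Weyl K) c) = C c := by
  rw [Algebra.algebraMap_eq_smul_one, map_smul, top_one, Polynomial.smul_eq_C_mul, mul_one]

theorem eq_algebraMap_of_top {ρ σ : ℤ} (hρ : 0 < ρ) (hσ : 0 ≤ σ) {P : Weyl K}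
    (h : P ∈ fil ρ σ 0) {c : K} (ht : top ρ σ 0 P = C c) : P = algebraMap K (Weyl K) c := by
  rw [← sub_eq_zero]
  apply eq_zero_of_mem_fil_neg hρ hσ (m := 0 - 1) (by norm_num)
  refine mem_fil_sub_one hρ.ne' (sub_mem h (algebraMap_mem_fil _ _ _)) ?_
  rw [map_sub, ht, top_algebraMap, sub_self]

theorem exists_eq_algebraMap {P : Weyl K} (h : P ∈ fil 1 1 0) :
    ∃ c : K, P = algebraMap K (Weyl K) c := by
  refine ⟨_, eq_algebraMap_of_top one_pos zero_le_one h
    (Polynomial.eq_C_of_natDegree_eq_zero (Nat.le_zero.1 (natDegree_top_le ?_)))⟩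
  intro i j hij; omega

theorem CommConst.ne_algebraMap {P Q : Weyl K} (h : CommConst P Q) (c : K) :
    P ≠ algebraMap K (Weyl K) c := by
  rintro rfl
  obtain ⟨d, hd, h⟩ := h
  rw [Algebra.commutes, sub_self] at h
  exact (hasDeg_algebraMap 1 1 hd).ne_zero h.symm

/-- The commutator is, up to sign, the determinant of the linear parts of $P$ and $Q$; since it is
nonzero, Cramer's rule recovers $X$ and $Y$. -/
theorem generators_mem_of_linear {P Q : Weyl K} (h : CommConst P Q) (hP : P ∈ fil 1 1 1)
    (hQ : Q ∈ fil 1 1 1) {S : Subalgebra K (Weyl K)} (hPS : P ∈ S) (hQS : Q ∈ S) :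
    X K ∈ S ∧ Y K ∈ S := by
  have main : ∀ R ∈ fil 1 1 1, R ∈ S → ∃ r s : K, top 1 1 1 R = C r + C s * Polynomial.X ∧
      r • X K + s • Y K ∈ S := by
    intro R hR hRS
    have hd : (top 1 1 1 R).natDegree ≤ 1 := natDegree_top_le fun i j hij => by omega
    have he := Polynomial.eq_X_add_C_of_natDegree_le_one hd
    refine ⟨(top 1 1 1 R).coeff 0, (top 1 1 1 R).coeff 1, by rw [add_comm]; exact he, ?_⟩
    set r := (top 1 1 1 R).coeff 0
    set s := (top 1 1 1 R).coeff 1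
    have h1 : R - (r • X K + s • Y K) ∈ fil 1 1 (1 - 1) := by
      refine mem_fil_sub_one one_ne_zero (sub_mem hR (add_mem
        (Submodule.smul_mem _ _ (X_mem_fil le_rfl)) (Submodule.smul_mem _ _ (Y_mem_fil le_rfl)))) ?_
      rw [map_sub, map_add, map_smul, map_smul, top_X, top_Y, he]
      simp only [Polynomial.smul_eq_C_mul]
      ring
    obtain ⟨c, hc⟩ := exists_eq_algebraMap h1
    have : r • X K + s • Y K = R - (R - (r • X K + s • Y K)) := by abel
    rw [this, hc]
    exact sub_mem hRS (S.algebraMap_mem _)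
  obtain ⟨r, s, ht, hS⟩ := main P hP hPS
  obtain ⟨r', s', ht', hS'⟩ := main Q hQ hQS
  obtain ⟨c, hc, hcomm⟩ := h
  have hb := top_comm (by norm_num) hP hQ
  have e : (1 : ℤ) + 1 - (1 + 1) = 0 := by norm_num
  rw [e, hcomm, top_algebraMap, ht, ht'] at hb
  simp only [Int.cast_one, one_smul, map_add, Polynomial.derivative_C, zero_add,
    Polynomial.derivative_C_mul, Polynomial.derivative_X, mul_one] at hb
  have hdet : c = r' * s - r * s' := by
    have := congrArg (Polynomial.eval 0) hb
    simpa using this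
  have hx : c • X K = s • (r' • X K + s' • Y K) - s' • (r • X K + s • Y K) := by
    rw [hdet]; module
  have hy : c • Y K = r' • (r • X K + s • Y K) - r • (r' • X K + s' • Y K) := by
    rw [hdet]; module
  constructor
  · have := S.smul_mem (hx ▸ sub_mem (S.smul_mem hS' s) (S.smul_mem hS s') : c • X K ∈ S) c⁻¹
    rwa [smul_smul, inv_mul_cancel₀ hc, one_smul] at this
  · have := S.smul_mem (hy ▸ sub_mem (S.smul_mem hS r') (S.smul_mem hS' r) : c • Y K ∈ S) c⁻¹
    rwa [smul_smul, inv_mul_cancel₀ hc, one_smul] at this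

theorem mem_fil_zero_of_lt {ρ σ v : ℤ} (hρ : 0 < ρ) (hσ : 0 < σ) (hv : v < ρ) {P : Weyl K}
    (h : P ∈ fil ρ σ v) : P ∈ fil 1 0 0 := by
  refine mem_fil.2 fun i j hij => ?_
  have h1 := mem_fil.1 h i j hij
  by_contra hc
  have hi : (1 : ℤ) ≤ i := by omega
  have : 0 ≤ σ * (j : ℤ) := by positivity
  nlinarith

variable [CharZero K]

/-- The kernel is stable under commutation with $X$ and $Y$, which lowers the degree. By induction
both commutators of a kernel element vanish, and then so does its leading form in characteristic
$0$. -/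
theorem endomorphism_injective (φ : Weyl K →ₐ[K] Weyl K) : Function.Injective φ := by
  have key : ∀ n : ℕ, ∀ P ∈ fil 1 1 (n : ℤ), φ P = 0 → P = 0 := by
    intro n
    induction n with
    | zero =>
      intro P hP h0
      obtain ⟨c, rfl⟩ := exists_eq_algebraMap (by simpa using hP)
      rw [AlgHom.commutes] at h0
      by_contra hne
      have hc : c ≠ 0 := by rintro rfl; simp at hne
      exact (hasDeg_algebraMap 1 1 hc).ne_zero h0
    | succ n ih =>
      intro P hP h0
      have hx := comm_mem_fil (by norm_num) hP (X_mem_fil (K := K) (ρ := 1) (σ := 1) le_rfl)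
      have hy := comm_mem_fil (by norm_num) hP (Y_mem_fil (K := K) (ρ := 1) (σ := 1) le_rfl)
      have hxt := top_comm (by norm_num) hP (X_mem_fil (K := K) (ρ := 1) (σ := 1) le_rfl)
      have hyt := top_comm (by norm_num) hP (Y_mem_fil (K := K) (ρ := 1) (σ := 1) le_rfl)
      have e : ((n + 1 : ℕ) : ℤ) + 1 - (1 + 1) = n := by push_cast; ring
      rw [e] at hx hy
      rw [ih _ hx (by simp [h0]), top_X] at hxt
      rw [ih _ hy (by simp [h0]), top_Y] at hyt
      simp only [map_zero, smul_zero, Int.cast_one, one_smul, one_mul, Polynomial.derivative_one,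
        mul_zero, sub_zero, Polynomial.derivative_X, mul_one] at hxt hyt
      rw [← hxt, mul_zero, zero_sub, eq_comm, neg_eq_zero, smul_eq_zero] at hyt
      have h1 : top 1 1 ((n + 1 : ℕ) : ℤ) P = 0 := by
        refine hyt.resolve_left ?_
        rw [Int.cast_natCast]
        exact_mod_cast Nat.succ_ne_zero n
      refine ih P ?_ h0
      have := mem_fil_sub_one one_ne_zero hP h1
      simpa using this
  rw [injective_iff_map_eq_zero]
  intro P h0
  by_contra hP
  obtain ⟨m, hm⟩ := exists_hasDeg_nat hP
  exact hP (key m P hm.1 h0)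

theorem bijective_of_generators_mem {φ : Weyl K →ₐ[K] Weyl K} (hX : X K ∈ φ.range)
    (hY : Y K ∈ φ.range) : Function.Bijective φ := by
  refine ⟨endomorphism_injective φ, fun P => ?_⟩
  have : P ∈ Submodule.span K (Set.range fun p : ℕ × ℕ => X K ^ p.1 * Y K ^ p.2) := by
    rw [span_monomials]; trivial
  have hle : Submodule.span K (Set.range fun p : ℕ × ℕ => X K ^ p.1 * Y K ^ p.2) ≤
      Subalgebra.toSubmodule φ.range := by
    rw [Submodule.span_le]
    rintro _ ⟨p, rfl⟩
    exact φ.range.mul_mem (pow_mem hX _) (pow_mem hY _)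
  exact hle this

/-- Here $P=p(Y)$. If $Q$ has $X$-degree $k$ with leading coefficient $q(Y)$, then $[P,Q]$ has
leading part $kqp'X^{k-1}$. Being a nonzero constant forces $k=1$ and $q,p'$ constant, so $P$ is
affine in $Y$ and $Q-\alpha X$ is a polynomial in $Y$. -/
theorem generators_mem_of_mem_fil_zero {P Q : Weyl K} (h : CommConst P Q) (hP : P ∈ fil 1 0 0)
    {S : Subalgebra K (Weyl K)} (hPS : P ∈ S) (hQS : Q ∈ S) : X K ∈ S ∧ Y K ∈ S := by
  have hne := h.ne_algebraMap
  obtain ⟨k, hQ⟩ := exists_hasDeg one_ne_zero 0 h.symm.ne_zero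
  obtain ⟨c, hc, hcomm⟩ := h
  have h0 := hQ.nonneg one_pos le_rfl
  have hC := hasDeg_algebraMap 1 0 hc
  have hmem := comm_mem_fil (by norm_num) hP hQ.1
  have ht := top_comm (by norm_num) hP hQ.1
  rw [hcomm] at hmem ht
  have hle := hC.le hmem
  have hp' : derivative (top 1 0 0 P) ≠ 0 := by
    intro hp
    have := Polynomial.eq_C_of_natDegree_eq_zero
      (Polynomial.derivative_eq_zero.1 hp)
    exact hne _ (eq_algebraMap_of_top one_pos le_rfl hP this)
  have hk : k = 1 := by
    by_contra hk
    rw [top_eq_zero_of_mem_fil (m := 0) (by omega) hC.1] at ht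
    simp only [smul_zero, Int.cast_zero, zero_smul, sub_zero] at ht
    rw [eq_comm, smul_eq_zero, mul_eq_zero] at ht
    rcases ht with ht | ht | ht
    · rw [Int.cast_eq_zero] at ht; omega
    · exact hQ.2 ht
    · exact hp' ht
  subst hk
  have e : (0 : ℤ) + 1 - (1 + 0) = 0 := by norm_num
  rw [e, top_algebraMap] at ht
  simp only [Int.cast_one, one_smul, Int.cast_zero, zero_smul, sub_zero] at ht
  have hdeg := congrArg Polynomial.natDegree ht
  rw [Polynomial.natDegree_C, Polynomial.natDegree_mul hQ.2 hp'] at hdeg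
  have hq := Polynomial.eq_C_of_natDegree_eq_zero (by omega : (top 1 0 1 Q).natDegree = 0)
  have hpd := Polynomial.eq_C_of_natDegree_eq_zero
    (by omega : (derivative (top 1 0 0 P)).natDegree = 0)
  set α := (top 1 0 1 Q).coeff 0
  set β := (derivative (top 1 0 0 P)).coeff 0
  have hα : α ≠ 0 := by intro h; rw [h, map_zero] at hq; exact hQ.2 hq
  have hβ : β ≠ 0 := by intro h; rw [h, map_zero] at hpd; exact hp' hpd
  have hYf : β • Y K ∈ fil 1 0 0 := Submodule.smul_mem _ _ (Y_mem_fil le_rfl)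
  have htY : top 1 0 0 (β • Y K) = C β * Polynomial.X := by
    rw [map_smul, top_Y, Polynomial.smul_eq_C_mul]
  have hder : derivative (top 1 0 0 (P - β • Y K)) = 0 := by
    rw [map_sub, htY, map_sub, hpd]; simp
  have hPe := eq_algebraMap_of_top one_pos le_rfl (sub_mem hP hYf)
    (Polynomial.eq_C_of_natDegree_eq_zero
      (Polynomial.derivative_eq_zero.1 hder))
  have hYS : Y K ∈ S := by
    have h1 : β • Y K ∈ S := by
      have : β • Y K = P - (P - β • Y K) := by abel
      rw [this, hPe]
      exact sub_mem hPS (S.algebraMap_mem _)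
    have := S.smul_mem h1 β⁻¹
    rwa [smul_smul, inv_mul_cancel₀ hβ, one_smul] at this
  refine ⟨?_, hYS⟩
  have hQX : Q - α • X K ∈ fil 1 0 (1 - 1) := by
    refine mem_fil_sub_one one_ne_zero
      (sub_mem hQ.1 (Submodule.smul_mem _ _ (X_mem_fil le_rfl))) ?_
    rw [map_sub, map_smul, top_X, hq, Polynomial.smul_eq_C_mul, mul_one, sub_self]
  have hQS' : Q - α • X K ∈ S := by
    refine fil_induction hQX (p := fun A => A ∈ S) ?_ (zero_mem S) (fun _ _ => add_mem)
      (fun c _ h => S.smul_mem h c)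
    intro i j hij
    have : i = 0 := by omega
    subst this
    simpa using pow_mem hYS j
  have h1 : α • X K ∈ S := by
    have : α • X K = Q - (Q - α • X K) := by abel
    rw [this]
    exact sub_mem hQS hQS'
  have := S.smul_mem h1 α⁻¹
  rwa [smul_smul, inv_mul_cancel₀ hα, one_smul] at this

theorem IsCounterexample.false_of_generators {P Q : Weyl K} (h : IsCounterexample P Q)
    (hg : ∀ S : Subalgebra K (Weyl K), P ∈ S → Q ∈ S → X K ∈ S ∧ Y K ∈ S) : False := by
  obtain ⟨f, rfl, rfl, hb⟩ := h
  obtain ⟨h1, h2⟩ := hg f.range ⟨_, rfl⟩ ⟨_, rfl⟩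
  exact hb (bijective_of_generators_mem h1 h2)

theorem IsCounterexample.left_not_mem {P Q : Weyl K} (h : IsCounterexample P Q) :
    P ∉ fil 1 0 0 := fun hP =>
  h.false_of_generators fun _ h1 h2 => generators_mem_of_mem_fil_zero h.commConst hP h1 h2

theorem IsCounterexample.right_not_mem {P Q : Weyl K} (h : IsCounterexample P Q) :
    Q ∉ fil 1 0 0 := fun hQ =>
  h.false_of_generators fun _ h1 h2 => generators_mem_of_mem_fil_zero h.commConst.symm hQ h2 h1

/-- A degree below $\rho$ would put $P$ or $Q$ in $K[Y]$, so both degrees are at least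
$\rho\ge\sigma$. Equality would make $\rho=\sigma$ and $P,Q$ affine; in either case $P,Q$ would
generate $A_1$. -/
theorem IsCounterexample.lt_add {P Q : Weyl K} (h : IsCounterexample P Q) {ρ σ v w : ℤ}
    (hσ : 0 < σ) (hρ : σ ≤ ρ) (hP : HasDeg ρ σ P v) (hQ : HasDeg ρ σ Q w) :
    ρ + σ < v + w ∧ 0 < v ∧ 0 < w := by
  have hv : ρ ≤ v := by
    by_contra! hlt; exact h.left_not_mem (mem_fil_zero_of_lt (by omega) hσ hlt hP.1)
  have hw : ρ ≤ w := by
    by_contra! hlt; exact h.right_not_mem (mem_fil_zero_of_lt (by omega) hσ hlt hQ.1)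
  refine ⟨?_, by omega, by omega⟩
  by_contra! hle
  have e1 : v = σ := by omega
  have e2 : w = σ := by omega
  have e3 : ρ = σ := by omega
  rw [e1, e3] at hP
  rw [e2, e3] at hQ
  have hlin : ∀ R ∈ fil σ σ σ, R ∈ fil (K := K) 1 1 1 := fun R hR => mem_fil.2 fun i j hij => by
    have := mem_fil.1 hR i j hij
    have : σ * ((i : ℤ) + j) ≤ σ * 1 := by linarith
    have := le_of_mul_le_mul_left this hσ
    linarith
  exact h.false_of_generators fun _ h1 h2 =>
    generators_mem_of_linear h.commConst (hlin _ hP.1) (hlin _ hQ.1) h1 h2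

end Dixmier

/-! ### Proportionality of degrees, and the use of minimality. -/

namespace Dixmier

open Polynomial (C derivative rootMultiplicity)

variable {K : Type*} [Field K]

theorem top_scale {k : ℤ} (hk : k ≠ 0) (ρ σ v : ℤ) :
    top (K := K) (k * ρ) (k * σ) (k * v) = top ρ σ v := by
  apply (monoBasis K).ext
  rintro ⟨i, j⟩
  rw [monoBasis_apply, top_mono, top_mono]
  congr 1
  rw [mul_assoc, mul_assoc, ← mul_add]
  exact propext (mul_right_inj' hk)

theorem hasDeg_scale {k : ℤ} (hk : 0 < k) {ρ σ v : ℤ} {P : Weyl K} :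
    HasDeg (k * ρ) (k * σ) P (k * v) ↔ HasDeg ρ σ P v := by
  rw [HasDeg, HasDeg, top_scale hk.ne', mem_fil, mem_fil]
  simp only [mul_assoc, ← mul_add, mul_le_mul_iff_of_pos_left hk]

/-- Increasing `ρ` by one changes the degree by the largest `x`-exponent on the leading edge, if the
difference of any two `x`-exponents divides `σ`. -/
theorem hasDeg_step {ρ σ v : ℤ} (hρ : 0 < ρ) (hσ : 0 < σ) {P : Weyl K} (hP : HasDeg ρ σ P v)
    {m : ℕ} (hm : P ∈ fil 1 0 m) (hdvd : ∀ d : ℕ, 0 < d → d ≤ m → (d : ℤ) ∣ σ) :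
    ∃ i : ℕ, ρ * i + σ * (rootMultiplicity 0 (top ρ σ v P) : ℕ) = v ∧
      HasDeg (ρ + 1) σ P (v + i) := by
  rw [Polynomial.rootMultiplicity_eq_natTrailingDegree']
  set n := (top ρ σ v P).natTrailingDegree with hn
  have hcn : (top ρ σ v P).coeff n ≠ 0 := by
    have := Polynomial.trailingCoeff_nonzero_iff_nonzero.2 hP.2
    exact this
  obtain ⟨i, hi⟩ := exists_of_coeff_top_ne hcn
  rw [coeff_top hρ.ne' hi] at hcn
  refine ⟨i, hi, mem_fil.2 fun k l hkl => ?_, top_ne_zero (by omega) (i := i) (j := n)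
    (by linarith) hcn⟩
  by_contra! hlt
  have h1 := mem_fil.1 hP.1 k l hkl
  have hik : (i : ℤ) < k := by linarith
  rcases h1.lt_or_eq with h2 | h2
  · have hkm : k ≤ m := by
      have := mem_fil.1 hm k l hkl
      omega
    -- A point $(k,l)$ of smaller degree that overtakes in one step would have a positive deficit
    -- less than $k-i$, yet the deficit is divisible by $k-i$.
    have hd : ((k - i : ℕ) : ℤ) ∣ σ := hdvd _ (by omega) (by omega)
    rw [Nat.cast_sub (by omega)] at hd
    have hd2 : ((k : ℤ) - i) ∣ v - (ρ * k + σ * l) := by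
      have : v - (ρ * k + σ * l) = σ * (n - l) - ρ * (k - i) := by rw [← hi]; ring
      rw [this]
      exact dvd_sub (hd.mul_right _) (Dvd.intro_left _ rfl)
    have := Int.le_of_dvd (by linarith) hd2
    linarith
  -- On the leading edge itself a larger $x$-exponent means a smaller $y$-exponent, but $n$ is the
  -- smallest.
  · have hc : (top ρ σ v P).coeff l ≠ 0 := by rwa [coeff_top hρ.ne' h2]
    have hnl := Polynomial.natTrailingDegree_le_of_ne_zero hc
    have h3 : ρ * ((k : ℤ) - i) = σ * (n - l) := by linarith
    have h4 : (n : ℤ) - l ≤ 0 := by rw [hn]; omega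
    have h5 : 0 < ρ * ((k : ℤ) - i) := mul_pos hρ (by linarith)
    have h6 : σ * ((n : ℤ) - l) ≤ 0 := mul_nonpos_of_nonneg_of_nonpos hσ.le h4
    linarith

theorem rootMultiplicity_proportional {f g : Polynomial K} {m n : ℕ} {c : K} (hc : c ≠ 0)
    (h : g ^ m = C c * f ^ n) (α : K) :
    m * rootMultiplicity α g = n * rootMultiplicity α f := by
  classical
  have h1 := congrArg (fun g => Multiset.count α g.roots) h
  simpa only [Polynomial.roots_C_mul _ hc, Polynomial.roots_pow, Multiset.count_nsmul,
    Polynomial.count_roots] using h1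

theorem IsMinimalPair.gcd_le {P Q P' Q' : Weyl K} (h : IsMinimalPair P Q)
    (h' : IsCounterexample P' Q') :
    Nat.gcd (totalDeg P) (totalDeg Q) ≤ Nat.gcd (totalDeg P') (totalDeg Q') := by
  have h1 : minGcd K ≤ ((Nat.gcd (totalDeg P') (totalDeg Q') : ℕ) : ℕ∞) :=
    iInf_le (fun p : {p : Weyl K × Weyl K // IsCounterexample p.1 p.2} =>
      ((Nat.gcd (totalDeg p.1.1) (totalDeg p.1.2) : ℕ) : ℕ∞)) ⟨(P', Q'), h'⟩
  rw [h.2] at h1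
  exact_mod_cast h1

theorem IsMinimalPair.map {P Q : Weyl K} (h : IsMinimalPair P Q) (φ : Weyl K ≃ₐ[K] Weyl K)
    (hφ : ∀ (R : Weyl K) (m : ℤ), HasDeg 1 1 R m → HasDeg 1 1 (φ R) m) :
    IsMinimalPair (φ P) (φ Q) := by
  refine ⟨h.1.map φ, ?_⟩
  obtain ⟨V, hV⟩ := exists_hasDeg_nat h.1.commConst.ne_zero
  obtain ⟨W, hW⟩ := exists_hasDeg_nat h.1.commConst.symm.ne_zero
  rw [totalDeg_eq_of_hasDeg (hφ _ _ hV), totalDeg_eq_of_hasDeg (hφ _ _ hW),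
    ← totalDeg_eq_of_hasDeg hV, ← totalDeg_eq_of_hasDeg hW]
  exact h.2

variable [CharZero K]

/-- The degrees of the members of a counterexample have the same ratio in all directions. -/
theorem IsCounterexample.ratio {P Q : Weyl K} (h : IsCounterexample P Q) {V W : ℕ}
    (hP : HasDeg 1 1 P V) (hQ : HasDeg 1 1 Q W) {ρ σ v w : ℤ} (hσ : 0 < σ) (hρ : σ ≤ ρ)
    (hPv : HasDeg ρ σ P v) (hQw : HasDeg ρ σ Q w) : v * W = w * V := by
  -- Scaling by $k$ makes the second weight divisible by every possible difference of $x$-exponents,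
  -- so `hasDeg_step` can be used along unit steps from $(k\sigma,k\sigma)$ to $(k\rho,k\sigma)$.
  set k : ℤ := (((V + W).factorial : ℕ) : ℤ) with hk
  have hk0 : 0 < k := by rw [hk]; exact_mod_cast Nat.factorial_pos _
  have hN : 0 < k * σ := mul_pos hk0 hσ
  have hdvd : ∀ d : ℕ, 0 < d → d ≤ V + W → (d : ℤ) ∣ k * σ := fun d h1 h2 =>
    Dvd.dvd.mul_right (by rw [hk]; exact_mod_cast Nat.dvd_factorial h1 h2) _
  have hfil : ∀ {R : Weyl K} {m : ℤ}, R ∈ fil 1 1 m → R ∈ fil 1 0 m := fun hR =>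
    mem_fil.2 fun i j hij => by have := mem_fil.1 hR i j hij; omega
  have main : ∀ n : ℕ, ∃ v w : ℤ, HasDeg (k * σ + n) (k * σ) P v ∧
      HasDeg (k * σ + n) (k * σ) Q w ∧ v * W = w * V := by
    intro n
    induction n with
    | zero =>
      have hs := fun (R : Weyl K) (m : ℤ) => (hasDeg_scale (ρ := 1) (σ := 1) (v := m) (P := R) hN)
      refine ⟨k * σ * V, k * σ * W, ?_, ?_, by ring⟩
      · simpa using (hs P V).2 hP
      · simpa using (hs Q W).2 hQ
    | succ n ih =>
      obtain ⟨v, w, hv, hw, hvw⟩ := ih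
      have hρ0 : 0 < k * σ + n := by omega
      obtain ⟨hlt, hv0, hw0⟩ := h.lt_add hN (by omega) hv hw
      obtain ⟨c, hc, hprop⟩ := top_pow_proportional hρ0 hN.le h.commConst hv hw hlt
      have hmul := rootMultiplicity_proportional hc hprop 0
      obtain ⟨i, hi, hvi⟩ := hasDeg_step hρ0 hN hv (m := V) (hfil hP.1)
        (fun d h1 h2 => hdvd d h1 (by omega))
      obtain ⟨i', hi', hwi⟩ := hasDeg_step hρ0 hN hw (m := W) (hfil hQ.1)
        (fun d h1 h2 => hdvd d h1 (by omega))
      rw [add_assoc] at hvi hwi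
      refine ⟨v + i, w + i', by exact_mod_cast hvi, by exact_mod_cast hwi, ?_⟩
      zify at hmul
      rw [Int.toNat_of_nonneg hv0.le, Int.toNat_of_nonneg hw0.le] at hmul
      -- Powers of the leading forms are proportional, so their lowest $y$-exponents, and hence
      -- their largest $x$-exponents, are in the ratio of the degrees.
      have h1 : v * (i' : ℤ) = w * i := by
        apply mul_left_cancel₀ hρ0.ne'
        linear_combination v * hi' - w * hi - (k * σ) * hmul
      have h2 : (i : ℤ) * W = i' * V := by
        apply mul_left_cancel₀ hv0.ne'
        linear_combination (i : ℤ) * hvw - (V : ℤ) * h1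
      linear_combination hvw + h2
  obtain ⟨n, hn⟩ := Int.eq_ofNat_of_zero_le (mul_nonneg hk0.le (sub_nonneg.2 hρ))
  obtain ⟨v', w', hv', hw', he⟩ := main n
  have e : k * σ + n = k * ρ := by rw [← hn]; ring
  rw [e] at hv' hw'
  rw [hv'.unique ((hasDeg_scale hk0).2 hPv), hw'.unique ((hasDeg_scale hk0).2 hQw)] at he
  apply mul_left_cancel₀ hk0.ne'
  linear_combination he

variable [IsAlgClosed K]

/-- The leading form of total degree of a member of a minimal pair is not a power of `y`: otherwise
an automorphism `X ↦ X + μ Y ^ m` would lower the degrees. -/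
theorem IsMinimalPair.top_ne_pow {P Q : Weyl K} (h : IsMinimalPair P Q) {V : ℕ}
    (hP : HasDeg 1 1 P V) {c : K} (hc : c ≠ 0) : top 1 1 V P ≠ C c * Polynomial.X ^ V := by
  classical
  intro htop
  obtain ⟨W, hQ⟩ := exists_hasDeg_nat h.1.commConst.symm.ne_zero
  obtain ⟨-, hV0, hW0⟩ := h.1.lt_add one_pos le_rfl hP hQ
  obtain ⟨ρ, σ, hσ, hρσ, hPd, hnd, j, hj, hcj⟩ := exists_edge (a := 0) (b := V) hc
    (by simpa using hP) (by simpa using htop) (by simpa using h.1.left_not_mem)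
  obtain ⟨-, m, rfl⟩ := edge_exponent h.1.commConst hσ hρσ hnd hPd hj hcj
  have hm : 2 ≤ m := by by_contra hc; nlinarith
  obtain ⟨m, rfl⟩ := Int.eq_ofNat_of_zero_le (by omega : 0 ≤ m)
  have hm2 : 2 ≤ m := by omega
  have e : σ * (m : ℤ) * ((0 : ℕ) : ℤ) + σ * V = σ * V := by simp
  have e1 : top (K := K) (σ * m) σ (σ * V) = top m 1 V := by
    have := top_scale (K := K) hσ.ne' m 1 V
    rwa [mul_one] at this
  rw [e, e1] at hnd hcj
  rw [e] at hPd
  have hP1 : HasDeg m 1 P V := by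
    refine (hasDeg_scale hσ).1 ?_
    rwa [mul_one]
  -- Without a nonzero root the edge form would be a multiple of $t^V$, but the edge has a second
  -- support point.
  have hroot : ∃ ν : K, ν ≠ 0 ∧ (top m 1 V P).eval ν = 0 := by
    by_contra! hno
    have hcard : (top m 1 V P).roots.toFinset.card ≤ 1 := by
      refine Finset.card_le_one.2 fun x hx y hy => ?_
      have hz : ∀ z ∈ (top m 1 V P).roots.toFinset, z = 0 := by
        intro z hz
        by_contra hz0
        exact hno z hz0 (Polynomial.isRoot_of_mem_roots (Multiset.mem_toFinset.1 hz))
      rw [hz x hx, hz y hy]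
    obtain ⟨d, α, n, hd, hf⟩ := eq_pow_of_card_roots_le_one hP1.2 hcard
    have hn : n = V := by
      rw [← hnd, hf, Polynomial.natDegree_C_mul hd, Polynomial.natDegree_pow,
        Polynomial.natDegree_X_sub_C, mul_one]
    have hα : α = 0 := by
      by_contra hα
      refine hno α hα ?_
      rw [hf]
      simp only [Polynomial.eval_mul, Polynomial.eval_pow, Polynomial.eval_sub, Polynomial.eval_X,
        Polynomial.eval_C, sub_self]
      rw [zero_pow (by omega), mul_zero]
    rw [hf, hα, hn] at hcj
    simp [Polynomial.coeff_X_pow, hj.ne] at hcj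
  obtain ⟨ν, hν, hev⟩ := hroot
  set φ := shearX (ν ^ m)⁻¹ m with hφ
  have hco : (top m 1 V (φ P)).coeff V = 0 := by
    have := coeff_top_shearX (μ := (ν ^ m)⁻¹) (V := V) (by omega)
      (mul_inv_cancel₀ (pow_ne_zero m hν)) hP1.1
    rw [hev, mul_eq_zero] at this
    exact this.resolve_left (pow_ne_zero _ hν)
  have hshear : ∀ (R : Weyl K) (v : ℤ), HasDeg m 1 R v → HasDeg m 1 (φ R) v := by
    intro R v hR
    have := shearX_hasDeg (m := m) (σ := 1) (by omega) one_pos (ν ^ m)⁻¹ (P := R) (V := v)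
      (by rwa [one_mul])
    rwa [one_mul] at this
  have h' := h.1.map φ
  obtain ⟨V', hV'⟩ := exists_hasDeg_nat h'.commConst.ne_zero
  obtain ⟨W', hW'⟩ := exists_hasDeg_nat h'.commConst.symm.ne_zero
  -- As $m\ge2$, the only point with $mi+j\le V\le i+j$ is $(0,V)$, whose coefficient has just been
  -- removed.
  have hlt : V' < V := by
    have hmem : φ P ∈ fil 1 1 ((V : ℤ) - 1) := by
      refine mem_fil.2 fun i l hil => ?_
      have h1 := mem_fil.1 (hshear P V hP1).1 i l hil
      rcases Nat.eq_zero_or_pos i with rfl | hi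
      · have hl : l ≠ V := by
          rintro rfl
          apply hil
          rw [← coeff_top (ρ := m) (σ := 1) (m := (l : ℤ)) (by omega) (by simp), hco]
        have : (l : ℤ) ≤ V := by simpa using h1
        omega
      · have : (2 : ℤ) * i ≤ m * i := mul_le_mul_of_nonneg_right (by omega) (by omega)
        omega
    have := hV'.le hmem
    omega
  -- The shear preserves $(m,1)$-degrees, so comparison with that weight shows that the total
  -- degrees have the same ratio before and after. A smaller $V'$ then gives a proportionally
  -- smaller gcd.
  obtain ⟨w, hw⟩ := exists_hasDeg (by omega : (m : ℤ) ≠ 0) 1 h.1.commConst.symm.ne_zero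
  have hr1 := h.1.ratio hP hQ one_pos (by omega) hP1 hw
  have hr2 := h'.ratio hV' hW' one_pos (by omega) (hshear _ _ hP1) (hshear _ _ hw)
  have hwW : w = W := by
    apply mul_right_cancel₀ hV0.ne'
    linear_combination -hr1
  rw [hwW] at hr2
  have hr : V * W' = W * V' := by exact_mod_cast hr2
  have hle := h.gcd_le h'
  rw [totalDeg_eq_of_hasDeg hP, totalDeg_eq_of_hasDeg hQ, totalDeg_eq_of_hasDeg hV',
    totalDeg_eq_of_hasDeg hW'] at hle
  have hg : V * Nat.gcd V' W' = V' * Nat.gcd V W := by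
    rw [← Nat.gcd_mul_left, ← Nat.gcd_mul_left, hr, mul_comm V V', mul_comm W V']
  have hg0 : 0 < Nat.gcd V W := Nat.gcd_pos_of_pos_left _ (by omega)
  nlinarith

end Dixmier

/-! ### Rectangular supports and starting points. -/

namespace Dixmier

open Polynomial (C derivative rootMultiplicity)

variable {K : Type*} [Field K]

/-- The support of `P` contains `(a, b)` and lies in the rectangle `[0, a] × [0, b]`. -/
structure IsRect (P : Weyl K) (a b : ℕ) : Prop where
  left : P ∈ fil 1 0 a
  right : P ∈ fil 0 1 b
  corner : cf a b P ≠ 0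

theorem IsRect.hasDeg {P : Weyl K} {a b : ℕ} (h : IsRect P a b) :
    HasDeg 1 1 P ((a + b : ℕ) : ℤ) := by
  refine ⟨mem_fil.2 fun i j hij => ?_, top_ne_zero one_ne_zero (by push_cast; ring) h.corner⟩
  have h1 := mem_fil.1 h.left i j hij
  have h2 := mem_fil.1 h.right i j hij
  omega

theorem IsRect.hasDeg_one_zero {P : Weyl K} {a b : ℕ} (h : IsRect P a b) : HasDeg 1 0 P a :=
  ⟨h.left, top_ne_zero one_ne_zero (by ring) h.corner⟩

theorem coeff_top_one_zero (P : Weyl K) (a j : ℕ) : (top 1 0 a P).coeff j = cf a j P :=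
  coeff_top one_ne_zero (by ring) P

theorem IsRect.natDegree_top {P : Weyl K} {a b : ℕ} (h : IsRect P a b) :
    (top 1 0 a P).natDegree = b := by
  apply le_antisymm
  · rw [Polynomial.natDegree_le_iff_coeff_eq_zero]
    intro j hj
    by_contra hc
    rw [coeff_top_one_zero] at hc
    have := mem_fil.1 h.right a j hc
    omega
  · apply Polynomial.le_natDegree_of_ne_zero
    rw [coeff_top_one_zero]
    exact h.corner

theorem IsRect.isSubrectangular {P : Weyl K} {a b : ℕ} (h : IsRect P a b) (ha : 0 < a)
    (hb : 0 < b) : IsSubrectangular P := by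
  refine ⟨a, b, by exact_mod_cast ha, by exact_mod_cast hb, mem_supp.2 ⟨a, b, rfl, h.corner⟩, ?_⟩
  intro p hp
  obtain ⟨i, j, rfl, hij⟩ := mem_supp.1 hp
  have h1 := mem_fil.1 h.left i j hij
  have h2 := mem_fil.1 h.right i j hij
  exact ⟨⟨by omega, by omega⟩, ⟨by omega, by omega⟩⟩

theorem coeff_top_swap {P : Weyl K} {V k : ℕ} (hk : k ≤ V) (hP : P ∈ fil 1 1 V) :
    (top 1 1 V (swap K P)).coeff k = (-1) ^ (V - k) * (top 1 1 V P).coeff (V - k) := by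
  refine top_map (φ := (swap K : Weyl K →ₐ[K] Weyl K)) (ρ' := 1) (σ' := 1) (by norm_num) ?_ ?_
    (Polynomial.lcoeff K k) (((-1 : K) ^ (V - k)) • Polynomial.lcoeff K (V - k)) ?_ hP
  · rw [AlgEquiv.coe_toAlgHom, swap_X]; exact Y_mem_fil le_rfl
  · rw [AlgEquiv.coe_toAlgHom, swap_Y]; exact Submodule.smul_mem _ _ (X_mem_fil le_rfl)
  · intro i j hij
    rw [AlgEquiv.coe_toAlgHom, swap_X, swap_Y, map_smul, top_X, top_Y]
    have hij' : i + j = V := by omega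
    have e : (Polynomial.X ^ i * ((-1 : K) • (1 : Polynomial K)) ^ j) =
        C ((-1) ^ j) * Polynomial.X ^ i := by
      rw [smul_pow, one_pow, Polynomial.smul_eq_C_mul]; ring
    rw [e]
    simp only [Polynomial.lcoeff_apply, Polynomial.coeff_C_mul, Polynomial.coeff_X_pow,
      LinearMap.smul_apply, smul_eq_mul]
    by_cases h : k = i
    · have h' : V - k = j := by omega
      rw [if_pos h, if_pos h', h']
    · have h' : V - k ≠ j := by omega
      rw [if_neg h, if_neg h', mul_zero, mul_zero]

theorem top_swap {P : Weyl K} {a b : ℕ} {c : K} (hP : HasDeg 1 1 P ((a + b : ℕ) : ℤ))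
    (ht : top 1 1 ((a + b : ℕ) : ℤ) P = C c * Polynomial.X ^ b) :
    top 1 1 ((b + a : ℕ) : ℤ) (swap K P) = C ((-1) ^ b * c) * Polynomial.X ^ a := by
  rw [add_comm b a]
  ext k
  by_cases hk : k ≤ a + b
  · rw [coeff_top_swap hk hP.1, ht]
    simp only [Polynomial.coeff_C_mul, Polynomial.coeff_X_pow]
    by_cases h : k = a
    · have h' : a + b - k = b := by omega
      rw [if_pos h, if_pos h', h']; ring
    · have h' : a + b - k ≠ b := by omega
      rw [if_neg h, if_neg h']; ring
  · rw [Polynomial.coeff_eq_zero_of_natDegree_lt, Polynomial.coeff_C_mul, Polynomial.coeff_X_pow,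
      if_neg (by omega), mul_zero]
    refine lt_of_le_of_lt (natDegree_top_le (n := a + b) fun i j h => ?_) (not_le.1 hk)
    omega

theorem IsRect.swap {P : Weyl K} {a b : ℕ} (h : IsRect P a b) : IsRect (swap K P) b a := by
  refine ⟨swap_mem_fil (by norm_num) h.right, swap_mem_fil (by norm_num) h.left, ?_⟩
  rw [← coeff_top (ρ := 1) (σ := 1) (m := ((a + b : ℕ) : ℤ)) one_ne_zero
      (by push_cast; ring),
    coeff_top_swap (by omega) h.hasDeg.1, show a + b - a = b by omega,
    coeff_top (i := a) one_ne_zero (by push_cast; ring)]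
  exact mul_ne_zero (pow_ne_zero _ (by simp)) h.corner

/-- With exponent $0$ the shear is the translation $Y\mapsto Y+\alpha$, which fixes $X$ and adds
only lower powers of $Y$. -/
theorem IsRect.shearY {P : Weyl K} {a b : ℕ} (h : IsRect P a b) (α : K) :
    IsRect (shearY α 0 P) a b ∧
      top 1 0 a (Dixmier.shearY α 0 P) = (top 1 0 a P).comp (Polynomial.X + C α) := by
  have h1 : HasDeg 1 0 (Dixmier.shearY α 0 P) a := by
    have := shearY_hasDeg (k := 0) α (by simpa using h.hasDeg_one_zero)
    simpa using this
  have h2 : top 1 0 a (Dixmier.shearY α 0 P) = (top 1 0 a P).comp (Polynomial.X + C α) := by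
    have := top_shearY (k := 0) α (P := P) (V := a) (by simpa using h.left)
    simpa using this
  refine ⟨⟨h1.1, ?_, ?_⟩, h2⟩
  · refine map_mem_fil (φ := (Dixmier.shearY α 0 : Weyl K →ₐ[K] Weyl K)) (by norm_num) ?_ ?_ h.right
    · rw [AlgEquiv.coe_toAlgHom, shearY_X]; exact X_mem_fil le_rfl
    · rw [AlgEquiv.coe_toAlgHom, shearY_Y]
      exact add_mem (Y_mem_fil le_rfl) (Submodule.smul_mem _ _ (X_pow_mem_fil _ (by simp)))
  · have hd : ((top 1 0 a P).comp (Polynomial.X + C α)).natDegree = b := by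
      rw [Polynomial.natDegree_comp, h.natDegree_top, Polynomial.natDegree_X_add_C, mul_one]
    rw [← coeff_top_one_zero, h2]
    nth_rewrite 1 [← hd]
    rw [Polynomial.coeff_natDegree, Polynomial.leadingCoeff_ne_zero, ← h2]
    exact h1.2

theorem shearY_zero_hasDeg (α : K) {P : Weyl K} {V : ℤ} (h : HasDeg 1 1 P V) :
    HasDeg 1 1 (shearY α 0 P) V := by
  have h1 : ∀ ν : K, Y K + ν • X K ^ 0 ∈ fil 1 1 1 := fun ν =>
    add_mem (Y_mem_fil le_rfl) (Submodule.smul_mem _ _ (X_pow_mem_fil _ (by simp)))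
  refine hasDeg_map one_ne_zero one_ne_zero (by norm_num) (by norm_num) _ ?_ ?_ ?_ ?_ h
  · rw [shearY_X]; exact X_mem_fil le_rfl
  · rw [shearY_Y]; exact h1 _
  · rw [shearY_symm_X]; exact X_mem_fil le_rfl
  · rw [shearY_symm_Y]; exact h1 _

theorem eq_monomial_of_pow_eq {g : Polynomial K} {n k : ℕ} (hn : 0 < n) {d : K} (hd : d ≠ 0)
    (h : g ^ n = C d * Polynomial.X ^ k) :
    ∃ (c : K) (b : ℕ), c ≠ 0 ∧ g = C c * Polynomial.X ^ b ∧ n * b = k := by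
  have h1 : g ∣ Polynomial.X ^ k := by
    have : g ∣ C d * Polynomial.X ^ k := h ▸ dvd_pow_self g hn.ne'
    exact (Polynomial.dvd_C_mul hd).1 this
  obtain ⟨b, -, u, hu⟩ := (dvd_prime_pow Polynomial.prime_X k).1 h1
  obtain ⟨r, hr, hru⟩ := Polynomial.isUnit_iff.1 (u⁻¹).isUnit
  have hr0 : r ≠ 0 := hr.ne_zero
  have hg : g = C r * Polynomial.X ^ b := by
    rw [hru, ← hu, mul_comm, mul_assoc, Units.mul_inv, mul_one]
  refine ⟨r, b, hr0, hg, ?_⟩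
  have h2 := congrArg Polynomial.natDegree h
  rw [hg, Polynomial.natDegree_pow, Polynomial.natDegree_C_mul_X_pow _ _ hr0,
    Polynomial.natDegree_C_mul_X_pow _ _ hd] at h2
  exact h2

theorem mem_polySupp_lead {P : Weyl K} {ρ σ m : ℤ} (hρ : ρ ≠ 0) (h : HasDeg ρ σ P m)
    {z : ℤ × ℤ} : z ∈ polySupp (lead ρ σ (Psi K P)) ↔ z ∈ supp P ∧ val ρ σ z = m := by
  classical
  have hd : polyDeg ρ σ (Psi K P) = (m : WithBot ℤ) := deg_eq_of_hasDeg hρ h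
  have hco : ∀ s, (lead ρ σ (Psi K P)).coeff s =
      if val ρ σ (point s) = m then (Psi K P).coeff s else 0 := by
    intro s
    rw [lead, MvPolynomial.coeff_sum]
    simp only [MvPolynomial.coeff_monomial, hd, WithBot.coe_inj]
    rw [Finset.sum_ite_eq']
    simp only [Finset.mem_filter, MvPolynomial.mem_support_iff]
    by_cases h1 : val ρ σ (point s) = m <;> by_cases h2 : (Psi K P).coeff s = 0 <;> simp [h1, h2]
  simp only [supp, polySupp, Finset.mem_image, MvPolynomial.mem_support_iff, hco]
  constructor
  · rintro ⟨s, hs, rfl⟩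
    have h1 : val ρ σ (point s) = m := by by_contra hne; simp [hne] at hs
    rw [if_pos h1] at hs
    exact ⟨⟨s, hs, rfl⟩, h1⟩
  · rintro ⟨⟨s, hs, rfl⟩, h1⟩
    exact ⟨s, by rwa [if_pos h1], rfl⟩

/-- At the starting point $v_{1,-1}$ takes its maximum over the $(1,0)$-leading support. All points
there have $i=a$, and divisibility by $t^{a+1}$ forces $j>a$. -/
theorem IsRect.val_st_neg {P : Weyl K} {a b : ℕ} (h : IsRect P a b)
    (hlow : Polynomial.X ^ (a + 1) ∣ top 1 0 a P) : val 1 (-1) (st 1 0 P) < 0 := by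
  have hmem := fun z => mem_polySupp_lead (z := z) one_ne_zero h.hasDeg_one_zero
  have hneg : ∀ z ∈ polySupp (lead 1 0 (Psi K P)), val 1 (-1) z < 0 := by
    intro z hz
    obtain ⟨hz1, hz2⟩ := (hmem z).1 hz
    obtain ⟨i, j, rfl, hij⟩ := mem_supp.1 hz1
    have hi : i = a := by simpa [val] using hz2
    subst hi
    have hj : ¬ j < i + 1 := by
      intro hj
      rw [← coeff_top_one_zero] at hij
      exact hij (Polynomial.X_pow_dvd_iff.1 hlow j hj)
    simp only [val]
    omega
  have hne : (polySupp (lead 1 0 (Psi K P))).Nonempty :=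
    ⟨((a : ℤ), (b : ℤ)), (hmem _).2 ⟨mem_supp.2 ⟨a, b, rfl, h.corner⟩, by simp [val]⟩⟩
  -- The leading support is nonempty, so the supremum is attained and the default $0$ of `unbotD`
  -- plays no role.
  obtain ⟨z, hz, hzd⟩ := Finset.exists_mem_eq_sup _ hne fun p => (val 1 (-1) p : WithBot ℤ)
  have hval : val 1 (-1) (st 1 0 P) = (polyDeg 1 (-1) (lead 1 0 (Psi K P))).unbotD 0 := by
    simp only [st, w, val]
    ring
  rw [hval, polyDeg, hzd]
  exact hneg z hz

variable [CharZero K]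

/-- For weight $(1,1)$, a root of multiplicity $V/2$ is excluded by `rootMultiplicity_G`, applied to
the root $0$ of multiplicity $b$. -/
theorem CommConst.corner_ne {P Q : Weyl K} (hPQ : CommConst P Q) {V b : ℕ} (hV : 0 < V)
    (hb : 0 < b) (hP : HasDeg 1 1 P V) {c : K} (hc : c ≠ 0)
    (ht : top 1 1 V P = C c * Polynomial.X ^ b) : b * 2 ≠ V := by
  obtain ⟨N, M, G, u, hB⟩ := exists_bracketData one_pos zero_le_one (by exact_mod_cast hV) hPQ hP
  rw [ht] at hB
  have h1 := (hB.rootMultiplicity_G (α := 0) one_ne_zero (by norm_num) (by exact_mod_cast hV)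
    (by simp [Polynomial.IsRoot, hb.ne'])).2
  have h2 : rootMultiplicity (0 : K) (C c * Polynomial.X ^ b) = b := by
    have := Polynomial.rootMultiplicity_X_sub_C_pow (0 : K) b
    rw [map_zero, sub_zero] at this
    rw [Polynomial.rootMultiplicity_mul (by simp [hc]), Polynomial.rootMultiplicity_C, zero_add,
      this]
  rw [h2] at h1
  intro h
  exact h1 (by exact_mod_cast h)

variable [IsAlgClosed K]

theorem mem_fil_of_top {P Q : Weyl K} (hPQ : CommConst P Q) {a b : ℕ} (ha : 0 < a)
    (hP : HasDeg 1 1 P ((a + b : ℕ) : ℤ)) {c : K} (hc : c ≠ 0)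
    (ht : top 1 1 ((a + b : ℕ) : ℤ) P = C c * Polynomial.X ^ b) : P ∈ fil 1 0 a := by
  by_contra hmem
  push_cast at hP ht
  obtain ⟨ρ, σ, hσ, hρσ, hPd, hnd, j, hj, hcj⟩ := exists_edge hc hP ht hmem
  exact ha.ne' (edge_exponent hPQ hσ hρσ hnd hPd hj hcj).1

/-- `mem_fil_of_top` bounds the support on the right; applied after exchanging the variables, it
bounds the support from above. -/
theorem isRect_of_top {P Q : Weyl K} (hPQ : CommConst P Q) {a b : ℕ} (ha : 0 < a) (hb : 0 < b)
    (hP : HasDeg 1 1 P ((a + b : ℕ) : ℤ)) {c : K} (hc : c ≠ 0)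
    (ht : top 1 1 ((a + b : ℕ) : ℤ) P = C c * Polynomial.X ^ b) : IsRect P a b := by
  refine ⟨mem_fil_of_top hPQ ha hP hc ht, ?_, ?_⟩
  · have h := swap_hasDeg hP
    rw [add_comm a b] at h
    exact mem_fil_of_swap (by norm_num) (mem_fil_of_top (hPQ.map (swap K)) hb h
      (mul_ne_zero (pow_ne_zero _ (by simp)) hc) (top_swap hP ht))
  · rw [← coeff_top (ρ := 1) (σ := 1) (m := ((a + b : ℕ) : ℤ)) one_ne_zero
      (by push_cast; ring), ht]
    simpa using hc

/-- A minimal pair can be made subrectangular, with proportional vertices off the diagonal. -/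
theorem IsMinimalPair.exists_isRect {P Q : Weyl K} (h : IsMinimalPair P Q) :
    ∃ φ : Weyl K ≃ₐ[K] Weyl K,
      (∀ (R : Weyl K) (m : ℤ), HasDeg 1 1 R m → HasDeg 1 1 (φ R) m) ∧
      ∃ a b a' b' : ℕ, 0 < a ∧ 0 < b ∧ 0 < a' ∧ 0 < b' ∧ a ≠ b ∧ a * b' = a' * b ∧
        IsRect (φ P) a b ∧ IsRect (φ Q) a' b' := by
  obtain ⟨V, hV⟩ := exists_hasDeg_nat h.1.commConst.ne_zero
  obtain ⟨W, hW⟩ := exists_hasDeg_nat h.1.commConst.symm.ne_zero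
  obtain ⟨hlt, hV0, hW0⟩ := h.1.lt_add one_pos le_rfl hV hW
  have hV0' : 0 < V := by omega
  obtain ⟨φ, hφ, c, b, hc, ht⟩ := exists_monomial_top h.1.commConst hV0' hV
  have hm := h.map φ hφ
  have hcomm := hm.1.commConst
  have hVφ := hφ P V hV
  have hWφ := hφ Q W hW
  have hbV : b ≤ V := by
    have hd : (top 1 1 (V : ℤ) (φ P)).natDegree ≤ V := natDegree_top_le fun i j hij => by omega
    rwa [ht, Polynomial.natDegree_C_mul_X_pow _ _ hc] at hd
  obtain ⟨a, rfl⟩ : ∃ a, V = a + b := ⟨V - b, by omega⟩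
  have ha : 0 < a := by
    by_contra ha
    obtain rfl : a = 0 := by omega
    rw [zero_add] at hVφ ht
    exact hm.top_ne_pow hVφ hc ht
  have hb : 0 < b := by
    by_contra hb
    obtain rfl : b = 0 := by omega
    -- A pure power of $x$ becomes a pure power of $y$ under the swap, so `top_ne_pow` excludes it
    -- too.
    have hs := hm.map (swap K) (fun R m => swap_hasDeg)
    have h1 := swap_hasDeg hVφ
    have h2 := top_swap hVφ ht
    rw [zero_add] at h2
    rw [add_zero] at h1
    exact hs.top_ne_pow h1 (mul_ne_zero (pow_ne_zero _ (by simp)) hc) h2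
  have hne := hcomm.corner_ne hV0' hb hVφ hc ht
  obtain ⟨d, hd, hprop⟩ := top_pow_proportional one_pos zero_le_one hcomm hVφ hWφ hlt
  rw [ht, Int.toNat_natCast, Int.toNat_natCast, mul_pow, ← Polynomial.C_pow, ← mul_assoc,
    ← Polynomial.C_mul,    ← pow_mul] at hprop
  -- A power of the leading form of $Q$ is a monomial, hence so is the form itself, and its vertex
  -- is proportional to that of $P$.
  obtain ⟨c', b', hc', ht', hb'⟩ :=
    eq_monomial_of_pow_eq hV0' (mul_ne_zero hd (pow_ne_zero _ hc)) hprop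
  have hb'W : b' < W := by
    by_contra hge
    have h1 : (a + b) * W ≤ b * W := hb' ▸ Nat.mul_le_mul_left _ (not_lt.1 hge)
    have h2 : 0 < a * W := Nat.mul_pos ha (by omega)
    nlinarith
  obtain ⟨a', rfl⟩ : ∃ a', W = a' + b' := ⟨W - b', by omega⟩
  have hb'0 : 0 < b' := by
    by_contra hz
    obtain rfl : b' = 0 := by omega
    rw [mul_zero, eq_comm] at hb'
    exact (Nat.mul_pos hb (by omega)).ne' hb'
  refine ⟨φ, hφ, a, b, a', b', ha, hb, by omega, hb'0, by omega, by nlinarith, ?_, ?_⟩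
  · exact isRect_of_top hcomm ha hb hVφ hc ht
  · exact isRect_of_top hcomm.symm (by omega) hb'0 hWφ hc' ht'

/-- For weight $(1,0)$ we have $V=a$ and $\deg f=b$, and no root has multiplicity exactly $a$. If
all multiplicities were less than $a$, their sum would give $b<ra$, whereas $r\le1$ or $ra\le b$. -/
theorem exists_root_multiplicity_lt {P Q : Weyl K} (hPQ : CommConst P Q) {a b : ℕ} (ha : 0 < a)
    (hab : a < b) (hP : IsRect P a b) :
    ∃ α : K, a < rootMultiplicity α (top 1 0 a P) := by
  classical
  have ha' : (0 : ℤ) < a := by exact_mod_cast ha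
  obtain ⟨N, M, G, u, hB⟩ := exists_bracketData one_pos le_rfl ha' hPQ hP.hasDeg_one_zero
  have hne := hP.hasDeg_one_zero.2
  have hsum := sum_rootMultiplicity (top 1 0 a P)
  rw [hP.natDegree_top] at hsum
  by_contra! hle
  have hlt : ∀ α ∈ (top 1 0 a P).roots.toFinset, rootMultiplicity α (top 1 0 a P) < a := by
    intro α hα
    have h1 := (hB.rootMultiplicity_G one_ne_zero (by norm_num) ha'
      (Polynomial.isRoot_of_mem_roots (Multiset.mem_toFinset.1 hα))).2
    refine lt_of_le_of_ne (hle α) fun he => h1 ?_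
    rw [he]; ring
  have hnon : (top 1 0 a P).roots.toFinset.Nonempty := by
    rw [Finset.nonempty_iff_ne_empty]
    rintro h0
    rw [h0, Finset.sum_empty] at hsum
    omega
  have h2 := Finset.sum_lt_sum_of_nonempty hnon hlt
  rw [hsum, Finset.sum_const, smul_eq_mul] at h2
  rcases hB.roots_cases one_ne_zero (by norm_num) ha' with h3 | ⟨-, -, h3⟩
  · have := Nat.mul_le_mul_right a h3
    omega
  · rw [hP.natDegree_top] at h3
    have h4 : (top 1 0 a P).roots.toFinset.card * a ≤ b := by
      have : ((top 1 0 a P).roots.toFinset.card : ℤ) * a ≤ b := by linarith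
      exact_mod_cast this
    omega

/-- Translating the heavy root to $0$ works for $P$ and $Q$ at once: powers of their $(1,0)$-leading
forms are proportional, so multiplicities scale like $a:a'$. -/
theorem exists_standard {P Q : Weyl K} (hPQ : CommConst P Q) {a b a' b' : ℕ} (ha : 0 < a)
    (ha' : 0 < a') (hab : a < b) (hP : IsRect P a b) (hQ : IsRect Q a' b') :
    ∃ α : K, val 1 (-1) (st 1 0 (shearY α 0 P)) < 0 ∧ val 1 (-1) (st 1 0 (shearY α 0 Q)) < 0 := by
  obtain ⟨α, hα⟩ := exists_root_multiplicity_lt hPQ ha hab hP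
  have key : ∀ {R : Weyl K} {c d : ℕ}, IsRect R c d → c < rootMultiplicity α (top 1 0 c R) →
      val 1 (-1) (st 1 0 (shearY α 0 R)) < 0 := by
    intro R c d hR hc
    obtain ⟨h1, h2⟩ := hR.shearY α
    apply h1.val_st_neg
    rw [h2]
    obtain ⟨g, hg⟩ := (Polynomial.le_rootMultiplicity_iff hR.hasDeg_one_zero.2).1
      (Nat.succ_le_of_lt hc)
    rw [hg]
    refine ⟨g.comp (Polynomial.X + C α), ?_⟩
    simp
  refine ⟨α, key hP hα, key hQ ?_⟩
  obtain ⟨d, hd, hprop⟩ := top_pow_proportional one_pos le_rfl hPQ hP.hasDeg_one_zero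
    hQ.hasDeg_one_zero (by omega)
  rw [Int.toNat_natCast, Int.toNat_natCast] at hprop
  have h1 := rootMultiplicity_proportional hd hprop α
  have h2 : a * a' < a * rootMultiplicity α (top 1 0 a' Q) := by
    rw [h1, mul_comm a a']; exact Nat.mul_lt_mul_of_pos_left hα ha'
  exact Nat.lt_of_mul_lt_mul_left h2

end Dixmier

/-! ### Assembly of both normal forms. -/

theorem mainTheorem7 {K : Type*} [Field K] [IsAlgClosed K] [CharZero K]
    (P Q : Dixmier.Weyl K) (hPQ : Dixmier.IsMinimalPair P Q) :
    (∃ φ : Dixmier.Weyl K ≃ₐ[K] Dixmier.Weyl K,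
      Dixmier.IsMinimalPair (φ P) (φ Q) ∧
      Dixmier.IsSubrectangular (φ P) ∧ Dixmier.IsSubrectangular (φ Q) ∧
      Dixmier.deg 1 1 (φ P) = Dixmier.deg 1 1 P ∧ Dixmier.deg 1 1 (φ Q) = Dixmier.deg 1 1 Q) ∧
    (∃ ψ : Dixmier.Weyl K ≃ₐ[K] Dixmier.Weyl K,
      Dixmier.IsStandardMinimalPair (ψ P) (ψ Q) ∧
      Dixmier.deg 1 1 (ψ P) = Dixmier.deg 1 1 P ∧
      Dixmier.deg 1 1 (ψ Q) = Dixmier.deg 1 1 Q) := by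
  have hdeg : ∀ (φ : Dixmier.Weyl K ≃ₐ[K] Dixmier.Weyl K),
      (∀ (R : Dixmier.Weyl K) (m : ℤ), Dixmier.HasDeg 1 1 R m → Dixmier.HasDeg 1 1 (φ R) m) →
      Dixmier.deg 1 1 (φ P) = Dixmier.deg 1 1 P ∧ Dixmier.deg 1 1 (φ Q) = Dixmier.deg 1 1 Q := by
    intro φ hφ
    obtain ⟨V, hV⟩ := Dixmier.exists_hasDeg_nat hPQ.1.commConst.ne_zero
    obtain ⟨W, hW⟩ := Dixmier.exists_hasDeg_nat hPQ.1.commConst.symm.ne_zero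
    rw [Dixmier.deg_eq_of_hasDeg one_ne_zero hV, Dixmier.deg_eq_of_hasDeg one_ne_zero hW,
      Dixmier.deg_eq_of_hasDeg one_ne_zero (hφ P V hV),
      Dixmier.deg_eq_of_hasDeg one_ne_zero (hφ Q W hW)]
    exact ⟨rfl, rfl⟩
  obtain ⟨φ, hφ, a, b, a', b', ha, hb, ha', hb', hab, hprop, hrP, hrQ⟩ := hPQ.exists_isRect
  refine ⟨⟨φ, hPQ.map φ hφ, hrP.isSubrectangular ha hb, hrQ.isSubrectangular ha' hb', hdeg φ hφ⟩,
    ?_⟩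
  have main : ∀ (χ : Dixmier.Weyl K ≃ₐ[K] Dixmier.Weyl K) (a b a' b' : ℕ),
      (∀ (R : Dixmier.Weyl K) (m : ℤ), Dixmier.HasDeg 1 1 R m → Dixmier.HasDeg 1 1 (χ R) m) →
      0 < a → 0 < a' → 0 < b' → a < b → Dixmier.IsRect (χ P) a b → Dixmier.IsRect (χ Q) a' b' →
      ∃ ψ : Dixmier.Weyl K ≃ₐ[K] Dixmier.Weyl K,
        Dixmier.IsStandardMinimalPair (ψ P) (ψ Q) ∧
        Dixmier.deg 1 1 (ψ P) = Dixmier.deg 1 1 P ∧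
        Dixmier.deg 1 1 (ψ Q) = Dixmier.deg 1 1 Q := by
    intro χ a b a' b' hχ ha ha' hb' hab hrP hrQ
    obtain ⟨α, h1, h2⟩ := Dixmier.exists_standard (hPQ.1.commConst.map χ) ha ha' hab hrP hrQ
    have hψ : ∀ (R : Dixmier.Weyl K) (m : ℤ), Dixmier.HasDeg 1 1 R m →
        Dixmier.HasDeg 1 1 ((χ.trans (Dixmier.shearY α 0)) R) m :=
      fun R m hR => Dixmier.shearY_zero_hasDeg α (hχ R m hR)
    exact ⟨χ.trans (Dixmier.shearY α 0), ⟨hPQ.map _ hψ,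
      (hrP.shearY α).1.isSubrectangular ha (by omega), (hrQ.shearY α).1.isSubrectangular ha' hb',
      h1, h2⟩, hdeg _ hψ⟩
  -- The vertex is off the diagonal; if $a>b$, exchanging the variables reduces to the case where
  -- the second coordinate is larger.
  rcases lt_or_gt_of_ne hab with hlt | hgt
  · exact main φ a b a' b' hφ ha ha' hb' hlt hrP hrQ
  · exact main (φ.trans (Dixmier.swap K)) b a b' a' (fun R m h => Dixmier.swap_hasDeg (hφ R m h))
      hb hb' ha' hgt hrP.swap hrQ.swap
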